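/- Let $M$ be a nonempty $n$-dimensional smooth manifold with a P-Sasakian structure $(\phi,\eta,\xi,g)$: $g$ is a Riemannian metric with Levi-Civita connection $\nabla$, $\phi$ is a smooth $(1,1)$-tensor field, $\eta$ a smooth $1$-form and $\xi$ a smooth vector field such that $$\phi^2=I-\eta\otimes\xi,\quad \eta(\xi)=1,\quad \phi\xi=0,\quad \eta\circ\phi=0,\quad g(X,Y)=g(\phi X,\phi Y)+\eta(X)\eta(Y),$$ $$(\nabla_X\phi)Y=-g(X,Y)\xi-\eta(Y)X+2\eta(X)\eta(Y)\xi .$$ Let $\pi:TM\to M$ be the tangent bundle, let $X^v$ and $X^h$ denote the vertical and the ($\nabla$-)horizontal lift to $TM$ of a vector field $X$ on $M$, and let $\phi^h,\eta^h,\eta^v$ be the lifts determined by $\phi^h(X^h)=(\phi X)^h$, $\phi^h(X^v)=(\phi X)^v$, $\eta^h(X^h)=0$, $\eta^h(X^v)=\eta(X)\circ\pi$, $\eta^v(X^h)=\eta(X)\circ\pi$, $\eta^v(X^v)=0$. Let $G$ be the Sasaki metric on $TM$: $G(X^v,Y^h)=0$, $G(X^v,Y^v)=G(X^h,Y^h)=g(X,Y)\circ\pi$.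 For positive integers $p,q$ put $\sigma_{p,q}=\frac{p+\sqrt{p^2+4q}}2$, $$F=\frac p2 I-\frac{2\sigma_{p,q}-p}{2}\bigl(\phi^h+\eta^h\otimes\xi^h+\eta^v\otimes\xi^v\bigr),\qquad \Phi'(\tilde X,\tilde Y)=G(\tilde X,F\tilde Y)-\frac p2\,G(\tilde X,\tilde Y).$$ For smooth vector fields $\tilde X,\tilde Y,\tilde Z$ on (an open subset of) $TM$ define $d\Phi'$ by the coboundary formula $$3\,d\Phi'(\tilde X,\tilde Y,\tilde Z)=\tilde X\Phi'(\tilde Y,\tilde Z)+\tilde Y\Phi'(\tilde Z,\tilde X)+\tilde Z\Phi'(\tilde X,\tilde Y)-\Phi'([\tilde X,\tilde Y],\tilde Z)-\Phi'([\tilde Z,\tilde X],\tilde Y)-\Phi'([\tilde Y,\tilde Z],\tilde X).$$ ($\Phi'$ is in fact a symmetric bilinear form, so $d\Phi'$ is understood as this expression in vector fields.) Then $\Phi'$ is never closed: there are smooth vector fields $\tilde X,\tilde Y,\tilde Z$ on $TM$ for which $d\Phi'(\tilde X,\tilde Y,\tilde Z)$ is not identically zero. Moreover, if $X$ is a smooth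 vector field on an open set $U\subseteq M$ with $\eta(X)=0$ and $g(X,X)=1$ on $U$, then $d\Phi'(X^h,X^v,\xi^v)\neq0$ at every point of $\pi^{-1}(U)$. -/

import Mathlib

open Bundle Manifold ContDiff

noncomputable section

namespace PSasakianLift

section Base

variable {E : Type*} [NormedAddCommGroup E] [NormedSpace ℝ E] [FiniteDimensional ℝ E]
  {M : Type*} [TopologicalSpace M] [ChartedSpace E M] [IsManifold 𝓘(ℝ, E) ∞ M]

/-- A section `X` of `TM` is a smooth vector field. -/
def IsSmoothField (X : ∀ x : M, TangentSpace 𝓘(ℝ, E) x) : Prop :=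
  ContMDiff 𝓘(ℝ, E) (𝓘(ℝ, E).prod 𝓘(ℝ, E)) ∞
    (fun x ↦ (⟨x, X x⟩ : TangentBundle 𝓘(ℝ, E) M))

/-- The vector field `X` is smooth on the set `U`. -/
def IsSmoothFieldOn (U : Set M) (X : ∀ x : M, TangentSpace 𝓘(ℝ, E) x) : Prop :=
  ContMDiffOn 𝓘(ℝ, E) (𝓘(ℝ, E).prod 𝓘(ℝ, E)) ∞
    (fun x ↦ (⟨x, X x⟩ : TangentBundle 𝓘(ℝ, E) M)) U

variable [RiemannianBundle (fun x : M ↦ TangentSpace 𝓘(ℝ, E) x)]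
  [IsContMDiffRiemannianBundle 𝓘(ℝ, E) ∞ E (fun x : M ↦ TangentSpace 𝓘(ℝ, E) x)]

/-- `nabla` is the Levi-Civita connection of the Riemannian metric on `M`: the smooth linear
connection which is torsion-free and compatible with the metric. -/
structure IsLeviCivita
    (nabla : CovariantDerivative 𝓘(ℝ, E) E (fun x : M ↦ TangentSpace 𝓘(ℝ, E) x)) : Prop where
  smooth : CovariantDerivative.ContMDiffCovariantDerivative nabla ∞
  torsion_free : nabla.torsion = 0
  metric : CovariantDerivative.IsMetricCompatible
    (V := fun x : M ↦ TangentSpace 𝓘(ℝ, E) x) nabla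

/-- `(phi, eta, xi, g)` is a P-Sasakian structure on `M`, where `g` is the Riemannian metric of `M`
and `nabla` its Levi-Civita connection. Here `nabla Y x v` is `∇_v Y` at `x`. -/
structure IsPSasakian
    (nabla : CovariantDerivative 𝓘(ℝ, E) E (fun x : M ↦ TangentSpace 𝓘(ℝ, E) x))
    (phi : ∀ x : M, TangentSpace 𝓘(ℝ, E) x →L[ℝ] TangentSpace 𝓘(ℝ, E) x)
    (eta : ∀ x : M, TangentSpace 𝓘(ℝ, E) x →L[ℝ] ℝ)
    (xi : ∀ x : M, TangentSpace 𝓘(ℝ, E) x) : Prop where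
  leviCivita : IsLeviCivita nabla
  smooth_phi : ContMDiff 𝓘(ℝ, E) (𝓘(ℝ, E).prod 𝓘(ℝ, E →L[ℝ] E)) ∞
    (fun x ↦ TotalSpace.mk' (E →L[ℝ] E)
      (E := fun x : M ↦ TangentSpace 𝓘(ℝ, E) x →L[ℝ] TangentSpace 𝓘(ℝ, E) x) x (phi x))
  smooth_eta : ContMDiff 𝓘(ℝ, E) (𝓘(ℝ, E).prod 𝓘(ℝ, E →L[ℝ] ℝ)) ∞
    (fun x ↦ TotalSpace.mk' (E →L[ℝ] ℝ)
      (E := fun x : M ↦ TangentSpace 𝓘(ℝ, E) x →L[ℝ] Bundle.Trivial M ℝ x) x (eta x))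
  smooth_xi : IsSmoothField xi
  phi_phi (x : M) (v : TangentSpace 𝓘(ℝ, E) x) : phi x (phi x v) = v - eta x v • xi x
  eta_xi (x : M) : eta x (xi x) = 1
  phi_xi (x : M) : phi x (xi x) = 0
  eta_phi (x : M) (v : TangentSpace 𝓘(ℝ, E) x) : eta x (phi x v) = 0
  metric (x : M) (v w : TangentSpace 𝓘(ℝ, E) x) :
    inner ℝ v w = inner ℝ (phi x v) (phi x w) + eta x v * eta x w
  /-- `(∇_X φ) Y = - g(X, Y) ξ - η(Y) X + 2 η(X) η(Y) ξ` -/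
  nabla_phi (x : M) (v : TangentSpace 𝓘(ℝ, E) x) (Y : ∀ y : M, TangentSpace 𝓘(ℝ, E) y) :
    IsSmoothField Y →
      nabla (fun y ↦ phi y (Y y)) x v - phi x (nabla Y x v) =
        -(inner ℝ v (Y x) : ℝ) • xi x - eta x (Y x) • v
          + (2 * eta x v * eta x (Y x)) • xi x

end Base

section Lifts

variable {E : Type*} [NormedAddCommGroup E] [NormedSpace ℝ E]
  {M : Type*} [TopologicalSpace M] [ChartedSpace E M] [IsManifold 𝓘(ℝ, E) ∞ M]

/-- The differential `π_*` at `u` of the projection `π : TM → M`. -/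
def projDeriv (u : TangentBundle 𝓘(ℝ, E) M) :
    TangentSpace (𝓘(ℝ, E).prod 𝓘(ℝ, E)) u →L[ℝ] TangentSpace 𝓘(ℝ, E) u.1 :=
  mfderiv (𝓘(ℝ, E).prod 𝓘(ℝ, E)) 𝓘(ℝ, E) (fun z : TangentBundle 𝓘(ℝ, E) M ↦ z.1) u

/-- The vertical lift `w ↦ w^v` at `u`, i.e. the differential at `u` of the inclusion into `TM` of
the fibre through `u`. -/
def vertLift (u : TangentBundle 𝓘(ℝ, E) M) :
    TangentSpace 𝓘(ℝ, E) u.1 →L[ℝ] TangentSpace (𝓘(ℝ, E).prod 𝓘(ℝ, E)) u :=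
  mfderiv 𝓘(ℝ, E) (𝓘(ℝ, E).prod 𝓘(ℝ, E))
    (fun w : E ↦ (⟨u.1, w⟩ : TangentBundle 𝓘(ℝ, E) M)) u.2

/-- The differential `s_*` at `π u` of the local section `s` of `TM` through `u` with constant
components in the chart at `π u`. -/
def sectionDeriv (u : TangentBundle 𝓘(ℝ, E) M) :
    TangentSpace 𝓘(ℝ, E) u.1 →L[ℝ] TangentSpace (𝓘(ℝ, E).prod 𝓘(ℝ, E)) u :=
  mfderiv 𝓘(ℝ, E) (𝓘(ℝ, E).prod 𝓘(ℝ, E))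
    (fun x : M ↦ (⟨x, FiberBundle.extend E u.2 x⟩ : TangentBundle 𝓘(ℝ, E) M)) u.1

/-- The differential `(dy^i)` at `u` of the fibre coordinates of `TM` in the trivialization of `TM`
at `π u`, which is the identity on the fibre `T_{π u} M`. -/
def fibreDeriv (u : TangentBundle 𝓘(ℝ, E) M) :
    TangentSpace (𝓘(ℝ, E).prod 𝓘(ℝ, E)) u →L[ℝ] TangentSpace 𝓘(ℝ, E) u.1 :=
  mfderiv (𝓘(ℝ, E).prod 𝓘(ℝ, E)) 𝓘(ℝ, E)
    (fun z : TangentBundle 𝓘(ℝ, E) M ↦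
      (trivializationAt E (fun x : M ↦ TangentSpace 𝓘(ℝ, E) x) u.1 z).2) u

/-- The linear map `v ↦ ∇_v s` at `π u`, where `s` is the local section of `TM` through `u` with
constant components in the chart at `π u`; its components are `Γ^l_{ij} v^i y^j`. -/
def christoffel (nabla : CovariantDerivative 𝓘(ℝ, E) E (fun x : M ↦ TangentSpace 𝓘(ℝ, E) x))
    (u : TangentBundle 𝓘(ℝ, E) M) : TangentSpace 𝓘(ℝ, E) u.1 →L[ℝ] TangentSpace 𝓘(ℝ, E) u.1 :=
  nabla (FiberBundle.extend E u.2) u.1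

/-- The horizontal lift `v ↦ v^h` at `u`: `v^h = s_* v - (∇_v s)^v` for a local section `s` of `TM`
through `u`; in the induced chart `v^h = v^i ∂/∂x^i - Γ^l_{ij} v^i y^j ∂/∂y^l`. -/
def horLift (nabla : CovariantDerivative 𝓘(ℝ, E) E (fun x : M ↦ TangentSpace 𝓘(ℝ, E) x))
    (u : TangentBundle 𝓘(ℝ, E) M) :
    TangentSpace 𝓘(ℝ, E) u.1 →L[ℝ] TangentSpace (𝓘(ℝ, E).prod 𝓘(ℝ, E)) u :=
  sectionDeriv u - (vertLift u).comp (christoffel nabla u)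

/-- The connection map `K : T_u TM → T_{π u} M`, with components `dy^i + Γ^i_{jk} y^j dx^k` in the
induced chart: it kills horizontal vectors and maps `w^v` to `w`. -/
def connMap (nabla : CovariantDerivative 𝓘(ℝ, E) E (fun x : M ↦ TangentSpace 𝓘(ℝ, E) x))
    (u : TangentBundle 𝓘(ℝ, E) M) :
    TangentSpace (𝓘(ℝ, E).prod 𝓘(ℝ, E)) u →L[ℝ] TangentSpace 𝓘(ℝ, E) u.1 :=
  fibreDeriv u + (christoffel nabla u).comp (projDeriv u)

/-- The vertical lift of a 1-form: `ω^v(X^h) = ω(X)`, `ω^v(X^v) = 0`. -/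
def formVert (om : ∀ x : M, TangentSpace 𝓘(ℝ, E) x →L[ℝ] ℝ) (u : TangentBundle 𝓘(ℝ, E) M) :
    TangentSpace (𝓘(ℝ, E).prod 𝓘(ℝ, E)) u →L[ℝ] ℝ :=
  (om u.1).comp (projDeriv u)

/-- The horizontal lift of a 1-form: `ω^h(X^h) = 0`, `ω^h(X^v) = ω(X)`. -/
def formHor (nabla : CovariantDerivative 𝓘(ℝ, E) E (fun x : M ↦ TangentSpace 𝓘(ℝ, E) x))
    (om : ∀ x : M, TangentSpace 𝓘(ℝ, E) x →L[ℝ] ℝ) (u : TangentBundle 𝓘(ℝ, E) M) :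
    TangentSpace (𝓘(ℝ, E).prod 𝓘(ℝ, E)) u →L[ℝ] ℝ :=
  (om u.1).comp (connMap nabla u)

/-- The horizontal lift of a (1,1)-tensor field: `φ^h(X^h) = (φ X)^h`, `φ^h(X^v) = (φ X)^v`. -/
def endoHor (nabla : CovariantDerivative 𝓘(ℝ, E) E (fun x : M ↦ TangentSpace 𝓘(ℝ, E) x))
    (phi : ∀ x : M, TangentSpace 𝓘(ℝ, E) x →L[ℝ] TangentSpace 𝓘(ℝ, E) x)
    (u : TangentBundle 𝓘(ℝ, E) M) :
    TangentSpace (𝓘(ℝ, E).prod 𝓘(ℝ, E)) u →L[ℝ] TangentSpace (𝓘(ℝ, E).prod 𝓘(ℝ, E)) u :=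
  (horLift nabla u).comp ((phi u.1).comp (projDeriv u))
  + (vertLift u).comp ((phi u.1).comp (connMap nabla u))

/-- The metallic mean `σ_{p,q}`. -/
def metallicMean (p q : ℕ) : ℝ := ((p : ℝ) + √((p : ℝ) ^ 2 + 4 * q)) / 2

/-- `F = (p/2) I - ((2 σ_{p,q} - p)/2) (φ^h + η^h ⊗ ξ^h + η^v ⊗ ξ^v)`. -/
def metallicF (nabla : CovariantDerivative 𝓘(ℝ, E) E (fun x : M ↦ TangentSpace 𝓘(ℝ, E) x))
    (phi : ∀ x : M, TangentSpace 𝓘(ℝ, E) x →L[ℝ] TangentSpace 𝓘(ℝ, E) x)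
    (eta : ∀ x : M, TangentSpace 𝓘(ℝ, E) x →L[ℝ] ℝ)
    (xi : ∀ x : M, TangentSpace 𝓘(ℝ, E) x) (p q : ℕ) (u : TangentBundle 𝓘(ℝ, E) M) :
    TangentSpace (𝓘(ℝ, E).prod 𝓘(ℝ, E)) u →L[ℝ] TangentSpace (𝓘(ℝ, E).prod 𝓘(ℝ, E)) u :=
  ((p : ℝ) / 2) • ContinuousLinearMap.id ℝ (TangentSpace (𝓘(ℝ, E).prod 𝓘(ℝ, E)) u)
  - ((2 * metallicMean p q - p) / 2) •
    (endoHor nabla phi u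
      + (formHor nabla eta u).smulRight (horLift nabla u (xi u.1))
      + (formVert eta u).smulRight (vertLift u (xi u.1)))

/-- A smooth vector field on the manifold `TM`. -/
def IsSmoothFieldTM
    (A : ∀ u : TangentBundle 𝓘(ℝ, E) M, TangentSpace (𝓘(ℝ, E).prod 𝓘(ℝ, E)) u) : Prop :=
  ContMDiff (𝓘(ℝ, E).prod 𝓘(ℝ, E))
    ((𝓘(ℝ, E).prod 𝓘(ℝ, E)).prod 𝓘(ℝ, E × E)) ∞
    (fun u ↦ (⟨u, A u⟩ : TangentBundle (𝓘(ℝ, E).prod 𝓘(ℝ, E)) (TangentBundle 𝓘(ℝ, E) M)))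

/-- The coboundary `dΦ(A, B, C)` of a field `Φ` of bilinear forms on `TM`, given by
`3 dΦ(A,B,C) = A Φ(B,C) + B Φ(C,A) + C Φ(A,B) - Φ([A,B],C) - Φ([C,A],B) - Φ([B,C],A)`. -/
def coboundary
    (Phi : ∀ u : TangentBundle 𝓘(ℝ, E) M, TangentSpace (𝓘(ℝ, E).prod 𝓘(ℝ, E)) u →
      TangentSpace (𝓘(ℝ, E).prod 𝓘(ℝ, E)) u → ℝ)
    (A B C : ∀ u : TangentBundle 𝓘(ℝ, E) M, TangentSpace (𝓘(ℝ, E).prod 𝓘(ℝ, E)) u)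
    (u : TangentBundle 𝓘(ℝ, E) M) : ℝ :=
  (mvfderiv (𝓘(ℝ, E).prod 𝓘(ℝ, E)) (fun z ↦ Phi z (B z) (C z)) u (A u)
    + mvfderiv (𝓘(ℝ, E).prod 𝓘(ℝ, E)) (fun z ↦ Phi z (C z) (A z)) u (B u)
    + mvfderiv (𝓘(ℝ, E).prod 𝓘(ℝ, E)) (fun z ↦ Phi z (A z) (B z)) u (C u)
    - Phi u (VectorField.mlieBracket (𝓘(ℝ, E).prod 𝓘(ℝ, E)) A B u) (C u)
    - Phi u (VectorField.mlieBracket (𝓘(ℝ, E).prod 𝓘(ℝ, E)) C A u) (B u)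
    - Phi u (VectorField.mlieBracket (𝓘(ℝ, E).prod 𝓘(ℝ, E)) B C u) (A u)) / 3

/-- `Φ` is closed: its coboundary vanishes on all smooth vector fields on `TM`. -/
def IsClosedForm
    (Phi : ∀ u : TangentBundle 𝓘(ℝ, E) M, TangentSpace (𝓘(ℝ, E).prod 𝓘(ℝ, E)) u →
      TangentSpace (𝓘(ℝ, E).prod 𝓘(ℝ, E)) u → ℝ) : Prop :=
  ∀ A B C : ∀ u : TangentBundle 𝓘(ℝ, E) M, TangentSpace (𝓘(ℝ, E).prod 𝓘(ℝ, E)) u,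
    IsSmoothFieldTM A → IsSmoothFieldTM B → IsSmoothFieldTM C →
      ∀ u, coboundary Phi A B C u = 0

variable [RiemannianBundle (fun x : M ↦ TangentSpace 𝓘(ℝ, E) x)]

/-- The Sasaki metric on `TM`: `G(X^v,Y^h) = 0`, `G(X^v,Y^v) = G(X^h,Y^h) = g(X,Y)`. -/
def sasakiMetric (nabla : CovariantDerivative 𝓘(ℝ, E) E (fun x : M ↦ TangentSpace 𝓘(ℝ, E) x))
    (u : TangentBundle 𝓘(ℝ, E) M) (Z W : TangentSpace (𝓘(ℝ, E).prod 𝓘(ℝ, E)) u) : ℝ :=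
  inner ℝ (projDeriv u Z) (projDeriv u W) + inner ℝ (connMap nabla u Z) (connMap nabla u W)

/-- `Φ'(Z, W) = G(Z, F W) - (p/2) G(Z, W)`. -/
def fundamentalForm
    (nabla : CovariantDerivative 𝓘(ℝ, E) E (fun x : M ↦ TangentSpace 𝓘(ℝ, E) x))
    (phi : ∀ x : M, TangentSpace 𝓘(ℝ, E) x →L[ℝ] TangentSpace 𝓘(ℝ, E) x)
    (eta : ∀ x : M, TangentSpace 𝓘(ℝ, E) x →L[ℝ] ℝ)
    (xi : ∀ x : M, TangentSpace 𝓘(ℝ, E) x) (p q : ℕ)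
    (u : TangentBundle 𝓘(ℝ, E) M) (Z W : TangentSpace (𝓘(ℝ, E).prod 𝓘(ℝ, E)) u) : ℝ :=
  sasakiMetric nabla u Z (metallicF nabla phi eta xi p q u W)
    - (p : ℝ) / 2 * sasakiMetric nabla u Z W

end Lifts

end PSasakianLift

end

/-! Put c = (2σ - p)/2 = √(p² + 4q)/2 > 0. The p/2 terms of Φ' cancel, and on lifts Φ'(X^v, Y^v) =
-c g(X, φY) and Φ'(X^v, Y^h) = Φ'(X^h, Y^v) = -c η(X)η(Y). Two further inputs are the brackets [X^h,
Y^v] = (∇_X Y)^v, [X^v, Y^v] = 0 (`mlieBracket_horLift_vertLift`, `mlieBracket_vertLift_vertLift`)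
and the identity ∇ξ = φ (`IsPSasakian.nabla_xi`).

If η(X) = 0, the three functions differentiated in dΦ'(X^h, X^v, ξ^v) vanish, and the only bracket
that contributes is [ξ^v, X^h] = -(φX)^v. Hence 3 dΦ' = -c g(φX, φX) = -c g(X, X), which is nonzero
wherever X is. A nonzero vector of ker η extends to a global field in ker η, so Φ' is not closed
when such a vector exists.

If ker η = 0 everywhere, the failure of dΦ' to be tensorial is used instead: on (f ξ^v, ξ^v, ξ^h),
with f the function η on TM, the derivative of f enters twice with the same sign and 3 dΦ' = -2c.

The brackets are computed in the induced charts of TM, where X^h is (X, -Γ(X, y)) and Y^v is (0, Y);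
the formula for [X^h, Y^v] reflects the linearity of Γ(X, y) in y. -/

noncomputable section

namespace PSasakianLift

open Filter Topology

/-! ### Calculus of vector-valued functions on manifolds -/

section VectorValued

variable {E : Type*} [NormedAddCommGroup E] [NormedSpace ℝ E]
  {H : Type*} [TopologicalSpace H] {I : ModelWithCorners ℝ E H}
  {N : Type*} [TopologicalSpace N] [ChartedSpace H N]
  {E' : Type*} [NormedAddCommGroup E'] [NormedSpace ℝ E']
  {H' : Type*} [TopologicalSpace H'] {I' : ModelWithCorners ℝ E' H'}
  {N' : Type*} [TopologicalSpace N'] [ChartedSpace H' N']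
  {F : Type*} [NormedAddCommGroup F] [NormedSpace ℝ F]
  {G : Type*} [NormedAddCommGroup G] [NormedSpace ℝ G]

lemma mvfderiv_comp_mfderiv_apply {g : N' → F} {f : N → N'} (x : N)
    (hg : MDifferentiableAt I' 𝓘(ℝ, F) g (f x)) (hf : MDifferentiableAt I I' f x)
    (v : TangentSpace I x) :
    mvfderiv I (fun z ↦ g (f z)) x v = mvfderiv I' g (f x) (mfderiv I I' f x v) :=
  mfderiv_comp_apply x hg hf v

lemma mvfderiv_clm_comp_apply (L : F →L[ℝ] G) {f : N → F} {x : N}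
    (hf : MDifferentiableAt I 𝓘(ℝ, F) f x) (v : TangentSpace I x) :
    mvfderiv I (fun z ↦ L (f z)) x v = L (mvfderiv I f x v) := by
  have := mfderiv_comp_apply (I' := 𝓘(ℝ, F)) (I'' := 𝓘(ℝ, G)) (g := L) x
    L.mdifferentiableAt hf v
  rw [L.mfderiv_eq] at this
  exact this

lemma mvfderiv_prodMk_apply {f : N → F} {g : N → G} {x : N}
    (hf : MDifferentiableAt I 𝓘(ℝ, F) f x) (hg : MDifferentiableAt I 𝓘(ℝ, G) g x)
    (v : TangentSpace I x) :
    mvfderiv I (fun z ↦ (f z, g z)) x v = (mvfderiv I f x v, mvfderiv I g x v) := by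
  have h := hf.prodMk_space hg
  exact Prod.ext (mvfderiv_clm_comp_apply (ContinuousLinearMap.fst ℝ F G) h v).symm
    (mvfderiv_clm_comp_apply (ContinuousLinearMap.snd ℝ F G) h v).symm

lemma mvfderiv_congr {f g : N → F} {x : N} (h : f =ᶠ[𝓝 x] g) :
    mvfderiv I f x = mvfderiv I g x := by
  ext v
  have := h.mfderiv_eq (I := I) (I' := 𝓘(ℝ, F))
  exact congrArg (fun L : E →L[ℝ] F ↦ L v) this

lemma mvfderiv_eq_zero_of_eventuallyEq_const {f : N → F} {x : N} {c : F}
    (h : ∀ᶠ z in 𝓝 x, f z = c) : mvfderiv I f x = 0 := by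
  rw [mvfderiv_congr (g := fun _ ↦ c) h, mvfderiv_const]

lemma mvfderiv_vectorSpace (f : E → F) (x : E) (v : E) :
    mvfderiv 𝓘(ℝ, E) f x v = fderiv ℝ f x v := by
  have := mfderiv_eq_fderiv (𝕜 := ℝ) (f := f) (x := x)
  exact congrArg (fun L : E →L[ℝ] F ↦ L v) this

end VectorValued

/-! ### Vector fields and Lie brackets in the chart at a point -/

section Chart

variable {E : Type*} [NormedAddCommGroup E] [NormedSpace ℝ E]
  {H : Type*} [TopologicalSpace H] {I : ModelWithCorners ℝ E H} [I.Boundaryless]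
  {N : Type*} [TopologicalSpace N] [ChartedSpace H N] [IsManifold I ∞ N]

omit [I.Boundaryless] in
-- The trivialization of the tangent bundle at `x` is the differential of the chart at `x`. This
-- reduces smoothness of the lifted fields to smoothness of their chart components.
lemma contMDiffAt_field_iff (V : ∀ x : N, TangentSpace I x) (x : N) :
    ContMDiffAt I I.tangent ∞ (fun z ↦ (⟨z, V z⟩ : TangentBundle I N)) x ↔
      ContMDiffAt I 𝓘(ℝ, E) ∞ (fun z ↦ mvfderiv I (extChartAt I x) z (V z)) x := by
  rw [contMDiffAt_section]
  refine Filter.EventuallyEq.contMDiffAt_iff ?_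
  filter_upwards [(chartAt H x).open_source.mem_nhds (mem_chart_source H x)] with z hz
  have hz' : z ∈ (trivializationAt E (TangentSpace I) x).baseSet := hz
  have := TangentBundle.continuousLinearMapAt_trivializationAt (I := I) hz
  rw [← Trivialization.continuousLinearMapAt_apply_of_mem ℝ _ hz']
  exact congrArg (fun L : E →L[ℝ] E ↦ L (V z)) this

lemma mpullbackWithin_extChartAt_symm_eventuallyEq (V : ∀ x : N, TangentSpace I x) (x : N) :
    (VectorField.mpullbackWithin 𝓘(ℝ, E) I (extChartAt I x).symm V (Set.range I) : E → E) =ᶠ[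
      𝓝 (extChartAt I x x)]
      fun p ↦ mvfderiv I (extChartAt I x) ((extChartAt I x).symm p) (V ((extChartAt I x).symm p)) := by
  filter_upwards [extChartAt_target_mem_nhds (I := I) x] with p hp
  rw [VectorField.mpullbackWithin_apply, ContinuousLinearMap.inverse_eq
    (mfderivWithin_extChartAt_symm_comp_mfderiv_extChartAt hp)
    (mfderiv_extChartAt_comp_mfderivWithin_extChartAt_symm hp)]
  rfl

/-- The manifold bracket is by definition the bracket of the pullbacks to the model space. Those
pullbacks are the chart components of the fields, so the classical formula DW(V) - DV(W) applies. -/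
lemma mvfderiv_extChartAt_mlieBracket (V W : ∀ x : N, TangentSpace I x) (x : N)
    (hV : MDifferentiableAt I 𝓘(ℝ, E) (fun z ↦ mvfderiv I (extChartAt I x) z (V z)) x)
    (hW : MDifferentiableAt I 𝓘(ℝ, E) (fun z ↦ mvfderiv I (extChartAt I x) z (W z)) x) :
    mvfderiv I (extChartAt I x) x (VectorField.mlieBracket I V W x) =
      mvfderiv I (fun z ↦ mvfderiv I (extChartAt I x) z (W z)) x (V x)
      - mvfderiv I (fun z ↦ mvfderiv I (extChartAt I x) z (V z)) x (W x) := by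
  set Vh : E → E := VectorField.mpullbackWithin 𝓘(ℝ, E) I (extChartAt I x).symm V (Set.range I)
    with hVh
  set Wh : E → E := VectorField.mpullbackWithin 𝓘(ℝ, E) I (extChartAt I x).symm W (Set.range I)
    with hWh
  have h1 : mvfderiv I (extChartAt I x) x (VectorField.mlieBracket I V W x) =
      VectorField.lieBracket ℝ Vh Wh (extChartAt I x x) := by
    rw [← VectorField.mlieBracketWithin_univ, VectorField.mlieBracketWithin_apply]
    have hs : (extChartAt I x).symm ⁻¹' Set.univ ∩ Set.range I = Set.univ := by
      simp [I.range_eq_univ]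
    rw [hs]
    refine ((isInvertible_mfderiv_extChartAt
      (mem_extChartAt_source (I := I) x)).self_apply_inverse _).trans ?_
    exact congrFun (VectorField.lieBracketWithin_univ (𝕜 := ℝ) (V := Vh) (W := Wh)) _
  -- Vectors at `x` are already written in the chart at `x`, so the derivative in that chart is the
  -- manifold derivative at `x`.
  have hrep : ∀ (Y : ∀ x : N, TangentSpace I x),
      MDifferentiableAt I 𝓘(ℝ, E) (fun z ↦ mvfderiv I (extChartAt I x) z (Y z)) x →
      ∀ w : E, fderiv ℝ (VectorField.mpullbackWithin 𝓘(ℝ, E) I (extChartAt I x).symm Y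
        (Set.range I) : E → E) (extChartAt I x x) w =
        mvfderiv I (fun z ↦ mvfderiv I (extChartAt I x) z (Y z)) x w := by
    intro Y hY w
    rw [(mpullbackWithin_extChartAt_symm_eventuallyEq Y x).fderiv_eq]
    have := hY.mvfderiv
    rw [I.range_eq_univ, fderivWithin_univ] at this
    exact (congrArg (fun L : E →L[ℝ] E ↦ L w) this).symm
  have hself : ∀ (Y : ∀ x : N, TangentSpace I x),
      (VectorField.mpullbackWithin 𝓘(ℝ, E) I (extChartAt I x).symm Y
        (Set.range I) : E → E) (extChartAt I x x) = Y x := by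
    intro Y
    rw [(mpullbackWithin_extChartAt_symm_eventuallyEq Y x).eq_of_nhds, extChartAt_to_inv]
    exact congrArg (fun L : E →L[ℝ] E ↦ L (Y x)) (mfderiv_extChartAt_self (I := I) (x := x))
  rw [h1, VectorField.lieBracket_eq]
  change fderiv ℝ Wh (extChartAt I x x) (Vh (extChartAt I x x)) -
    fderiv ℝ Vh (extChartAt I x x) (Wh (extChartAt I x x)) = _
  rw [hVh, hWh, hself, hself]
  exact congrArg₂ (· - ·) (hrep W hW (V x)) (hrep V hV (W x))

end Chart

/-! ### Fibre coordinates of the tangent bundle and the induced charts -/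

section FibreCoordinates

variable {E : Type*} [NormedAddCommGroup E] [NormedSpace ℝ E]
  {M : Type*} [TopologicalSpace M] [ChartedSpace E M] [IsManifold 𝓘(ℝ, E) ∞ M]

/-- The fibre coordinates of `TM` in the trivialization at `x₀`. -/
def fibCoord (x₀ : M) (z : TangentBundle 𝓘(ℝ, E) M) : E :=
  (trivializationAt E (fun x : M ↦ TangentSpace 𝓘(ℝ, E) x) x₀ z).2

/-- The local section of `TM` with constant components `w` in the trivialization at `x₀`. -/
def constSection (x₀ : M) (w : E) (x : M) : TangentSpace 𝓘(ℝ, E) x :=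
  (trivializationAt E (fun x : M ↦ TangentSpace 𝓘(ℝ, E) x) x₀).symm x w

lemma fibCoord_mk (x₀ : M) {x : M} (hx : x ∈ (chartAt E x₀).source) (v : TangentSpace 𝓘(ℝ, E) x) :
    fibCoord x₀ ⟨x, v⟩ = (trivializationAt E (fun x : M ↦ TangentSpace 𝓘(ℝ, E) x)
      x₀).continuousLinearMapAt ℝ x v :=
  (Trivialization.continuousLinearMapAt_apply_of_mem ℝ _ (by exact hx) v).symm

lemma fibCoord_add (x₀ : M) {x : M} (hx : x ∈ (chartAt E x₀).source)
    (v w : TangentSpace 𝓘(ℝ, E) x) :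
    fibCoord x₀ ⟨x, v + w⟩ = fibCoord x₀ ⟨x, v⟩ + fibCoord x₀ ⟨x, w⟩ := by
  simp only [fibCoord_mk x₀ hx, map_add]

lemma fibCoord_smul (x₀ : M) {x : M} (hx : x ∈ (chartAt E x₀).source)
    (c : ℝ) (v : TangentSpace 𝓘(ℝ, E) x) :
    fibCoord x₀ ⟨x, c • v⟩ = c • fibCoord x₀ ⟨x, v⟩ := by
  simp only [fibCoord_mk x₀ hx, map_smul]

lemma fibCoord_zero (x₀ : M) {x : M} (hx : x ∈ (chartAt E x₀).source) :
    fibCoord x₀ ⟨x, (0 : TangentSpace 𝓘(ℝ, E) x)⟩ = 0 := by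
  simp only [fibCoord_mk x₀ hx, map_zero]

/-- Over its own base point the trivialization is the identity, since the differential of the
preferred chart is. -/
lemma fibCoord_self (x : M) (v : TangentSpace 𝓘(ℝ, E) x) : fibCoord x ⟨x, v⟩ = v := by
  have h := TangentBundle.continuousLinearMapAt_trivializationAt (I := 𝓘(ℝ, E))
    (mem_chart_source E x)
  rw [fibCoord_mk x (mem_chart_source E x)]
  exact (congrArg (fun L : E →L[ℝ] E ↦ L v) h).trans
    (congrArg (fun L : E →L[ℝ] E ↦ L v) (mfderiv_extChartAt_self (I := 𝓘(ℝ, E)) (x := x)))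

lemma fibCoord_eq_mvfderiv (x₀ : M) {x : M} (hx : x ∈ (chartAt E x₀).source)
    (v : TangentSpace 𝓘(ℝ, E) x) :
    fibCoord x₀ ⟨x, v⟩ = mvfderiv 𝓘(ℝ, E) (extChartAt 𝓘(ℝ, E) x₀) x v := by
  rw [fibCoord_mk x₀ hx]
  exact congrArg (fun L : E →L[ℝ] E ↦ L v)
    (TangentBundle.continuousLinearMapAt_trivializationAt (I := 𝓘(ℝ, E)) hx)

lemma fibCoord_constSection (x₀ : M) {x : M} (hx : x ∈ (chartAt E x₀).source) (w : E) :
    fibCoord x₀ ⟨x, constSection x₀ w x⟩ = w :=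
  congrArg Prod.snd (Trivialization.apply_mk_symm _ (by exact hx) w)

lemma constSection_fibCoord (x₀ : M) {x : M} (hx : x ∈ (chartAt E x₀).source)
    (v : TangentSpace 𝓘(ℝ, E) x) :
    constSection x₀ (fibCoord x₀ ⟨x, v⟩) x = v :=
  Trivialization.symm_apply_apply_mk _ (by exact hx) v

lemma extend_eq_constSection (x : M) (v : TangentSpace 𝓘(ℝ, E) x) :
    FiberBundle.extend E v = constSection (E := E) x (show E from v) := by
  funext y
  exact congrArg (fun w ↦ constSection x w y) (fibCoord_self x v)

lemma contMDiffAt_fibCoord (x₀ : M) {z : TangentBundle 𝓘(ℝ, E) M}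
    (hz : z.1 ∈ (chartAt E x₀).source) :
    ContMDiffAt (𝓘(ℝ, E).prod 𝓘(ℝ, E)) 𝓘(ℝ, E) ∞ (fibCoord x₀) z := by
  have h := (Trivialization.contMDiffOn (n := ∞) (IB := 𝓘(ℝ, E))
    (trivializationAt E (fun x : M ↦ TangentSpace 𝓘(ℝ, E) x) x₀)).contMDiffAt (x := z)
    ((trivializationAt E (fun x : M ↦ TangentSpace 𝓘(ℝ, E) x) x₀).open_source.mem_nhds
      ((Trivialization.mem_source _).2 hz))
  exact h.snd

lemma contMDiffAt_section_iff_fibCoord (x₀ : M) (X : ∀ x : M, TangentSpace 𝓘(ℝ, E) x) {x : M}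
    (hx : x ∈ (chartAt E x₀).source) :
    ContMDiffAt 𝓘(ℝ, E) (𝓘(ℝ, E).prod 𝓘(ℝ, E)) ∞
      (fun y ↦ (⟨y, X y⟩ : TangentBundle 𝓘(ℝ, E) M)) x ↔
    ContMDiffAt 𝓘(ℝ, E) 𝓘(ℝ, E) ∞ (fun y ↦ fibCoord x₀ ⟨y, X y⟩) x :=
  Trivialization.contMDiffAt_section_iff
    (trivializationAt E (fun x : M ↦ TangentSpace 𝓘(ℝ, E) x) x₀) (by exact hx)

lemma contMDiffAt_constSection (x₀ : M) (w : E) {x : M} (hx : x ∈ (chartAt E x₀).source) :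
    ContMDiffAt 𝓘(ℝ, E) (𝓘(ℝ, E).prod 𝓘(ℝ, E)) ∞
      (fun y ↦ (⟨y, constSection x₀ w y⟩ : TangentBundle 𝓘(ℝ, E) M)) x := by
  rw [contMDiffAt_section_iff_fibCoord x₀ _ hx]
  refine contMDiffAt_const (c := w) |>.congr_of_eventuallyEq ?_
  filter_upwards [(chartAt E x₀).open_source.mem_nhds hx] with y hy
  exact fibCoord_constSection x₀ hy w

/-- The projection `TM → M` is smooth. -/
lemma contMDiff_bundleProj :
    ContMDiff (𝓘(ℝ, E).prod 𝓘(ℝ, E)) 𝓘(ℝ, E) ∞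
      (fun z : TangentBundle 𝓘(ℝ, E) M ↦ z.1) :=
  contMDiff_proj _

lemma contMDiff_fibreInclusion (x : M) :
    ContMDiff 𝓘(ℝ, E) (𝓘(ℝ, E).prod 𝓘(ℝ, E)) ∞
      (fun w : E ↦ (⟨x, w⟩ : TangentBundle 𝓘(ℝ, E) M)) := by
  intro w
  rw [contMDiffAt_totalSpace]
  refine ⟨contMDiffAt_const, ?_⟩
  have h : ContMDiffAt 𝓘(ℝ, E) 𝓘(ℝ, E) ∞ (fun w : E ↦ w) w := contMDiffAt_id
  refine h.congr_of_eventuallyEq (Eventually.of_forall fun v ↦ fibCoord_self x v)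

lemma extChartAt_tangentBundle (u z : TangentBundle 𝓘(ℝ, E) M) :
    extChartAt (𝓘(ℝ, E).prod 𝓘(ℝ, E)) u z =
      (extChartAt 𝓘(ℝ, E) u.1 z.1, fibCoord u.1 z) := by
  rw [FiberBundle.extChartAt]
  rfl

lemma projDeriv_vertLift (u : TangentBundle 𝓘(ℝ, E) M) (w : TangentSpace 𝓘(ℝ, E) u.1) :
    projDeriv u (vertLift u w) = 0 := by
  have h := mfderiv_comp_apply (I := 𝓘(ℝ, E)) (I' := 𝓘(ℝ, E).prod 𝓘(ℝ, E)) (I'' := 𝓘(ℝ, E))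
    (g := fun z : TangentBundle 𝓘(ℝ, E) M ↦ z.1)
    (f := fun w : E ↦ (⟨u.1, w⟩ : TangentBundle 𝓘(ℝ, E) M)) u.2
    ((contMDiff_bundleProj _).mdifferentiableAt (by simp))
    ((contMDiff_fibreInclusion u.1 _).mdifferentiableAt (by simp)) w
  have hc : mfderiv 𝓘(ℝ, E) 𝓘(ℝ, E) ((fun z : TangentBundle 𝓘(ℝ, E) M ↦ z.1) ∘
    (fun w : E ↦ (⟨u.1, w⟩ : TangentBundle 𝓘(ℝ, E) M))) u.2 = 0 := mfderiv_const
  rw [hc] at h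
  exact h.symm

lemma mvfderiv_fibCoord_vertLift (x₀ : M) (u : TangentBundle 𝓘(ℝ, E) M)
    (hu : u.1 ∈ (chartAt E x₀).source) (w : TangentSpace 𝓘(ℝ, E) u.1) :
    mvfderiv (𝓘(ℝ, E).prod 𝓘(ℝ, E)) (fibCoord x₀) u (vertLift u w) = fibCoord x₀ ⟨u.1, w⟩ := by
  have h := mvfderiv_comp_mfderiv_apply (I := 𝓘(ℝ, E)) (I' := 𝓘(ℝ, E).prod 𝓘(ℝ, E))
    (g := fibCoord x₀)
    (f := fun w : E ↦ (⟨u.1, w⟩ : TangentBundle 𝓘(ℝ, E) M)) u.2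
    ((contMDiffAt_fibCoord x₀ hu).mdifferentiableAt (by simp))
    ((contMDiff_fibreInclusion u.1 _).mdifferentiableAt (by simp)) w
  rw [fibCoord_mk x₀ hu]
  refine h.symm.trans ?_
  let L : E →L[ℝ] E := (trivializationAt E (fun x : M ↦ TangentSpace 𝓘(ℝ, E) x)
      x₀).continuousLinearMapAt ℝ u.1
  have e : (fun w : E ↦ fibCoord x₀ (⟨u.1, w⟩ : TangentBundle 𝓘(ℝ, E) M)) = L :=
    funext fun w ↦ fibCoord_mk x₀ hu w
  rw [e]
  exact (mvfderiv_vectorSpace _ _ _).trans (congrArg (fun K : E →L[ℝ] E ↦ K w) L.fderiv)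

lemma mvfderiv_comp_proj_apply {F : Type*} [NormedAddCommGroup F] [NormedSpace ℝ F] {f : M → F}
    (u : TangentBundle 𝓘(ℝ, E) M) (hf : MDifferentiableAt 𝓘(ℝ, E) 𝓘(ℝ, F) f u.1)
    (Z : TangentSpace (𝓘(ℝ, E).prod 𝓘(ℝ, E)) u) :
    mvfderiv (𝓘(ℝ, E).prod 𝓘(ℝ, E)) (fun z ↦ f z.1) u Z = mvfderiv 𝓘(ℝ, E) f u.1 (projDeriv u Z) :=
  mvfderiv_comp_mfderiv_apply u hf ((contMDiff_bundleProj _).mdifferentiableAt (by simp)) Z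

lemma mvfderiv_extChartAt_tangentBundle (u z : TangentBundle 𝓘(ℝ, E) M)
    (hz : z.1 ∈ (chartAt E u.1).source) (Z : TangentSpace (𝓘(ℝ, E).prod 𝓘(ℝ, E)) z) :
    mvfderiv (𝓘(ℝ, E).prod 𝓘(ℝ, E)) (extChartAt (𝓘(ℝ, E).prod 𝓘(ℝ, E)) u) z Z =
      (fibCoord u.1 ⟨z.1, projDeriv z Z⟩,
        mvfderiv (𝓘(ℝ, E).prod 𝓘(ℝ, E)) (fibCoord u.1) z Z) := by
  have hext : MDifferentiableAt 𝓘(ℝ, E) 𝓘(ℝ, E) (extChartAt 𝓘(ℝ, E) u.1) z.1 :=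
    mdifferentiableAt_extChartAt hz
  have e : (extChartAt (𝓘(ℝ, E).prod 𝓘(ℝ, E)) u : TangentBundle 𝓘(ℝ, E) M → E × E) =
      fun z ↦ (extChartAt 𝓘(ℝ, E) u.1 z.1, fibCoord u.1 z) :=
    funext fun z ↦ extChartAt_tangentBundle u z
  rw [e, fibCoord_eq_mvfderiv u.1 hz, ← mvfderiv_comp_proj_apply z hext]
  exact mvfderiv_prodMk_apply
    (hext.comp z ((contMDiff_bundleProj _).mdifferentiableAt (by simp)))
    ((contMDiffAt_fibCoord u.1 hz).mdifferentiableAt (by simp)) Z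

lemma fibreDeriv_eq (u : TangentBundle 𝓘(ℝ, E) M) (Z : TangentSpace (𝓘(ℝ, E).prod 𝓘(ℝ, E)) u) :
    fibreDeriv u Z = mvfderiv (𝓘(ℝ, E).prod 𝓘(ℝ, E)) (fibCoord u.1) u Z := rfl

end FibreCoordinates

/-! ### Christoffel symbols of the connection -/

section Connection

variable {E : Type*} [NormedAddCommGroup E] [NormedSpace ℝ E]
  {M : Type*} [TopologicalSpace M] [ChartedSpace E M] [IsManifold 𝓘(ℝ, E) ∞ M]
  (nabla : CovariantDerivative 𝓘(ℝ, E) E (fun x : M ↦ TangentSpace 𝓘(ℝ, E) x))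

lemma mdifferentiableAt_fibCoord_section {σ : ∀ x : M, TangentSpace 𝓘(ℝ, E) x} (x₀ : M) {x : M}
    (hx : x ∈ (chartAt E x₀).source)
    (hσ : MDifferentiableAt 𝓘(ℝ, E) (𝓘(ℝ, E).prod 𝓘(ℝ, E))
      (fun y ↦ (⟨y, σ y⟩ : TangentBundle 𝓘(ℝ, E) M)) x) :
    MDifferentiableAt 𝓘(ℝ, E) 𝓘(ℝ, E) (fun y ↦ fibCoord x₀ ⟨y, σ y⟩) x :=
  MDifferentiableAt.comp (g := fibCoord x₀) x
    ((contMDiffAt_fibCoord x₀ (by exact hx)).mdifferentiableAt (by simp)) hσ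

/-- Both ∇ and the flat derivative of the chart obey the Leibniz rule with the same term df(v)σ,
which cancels in the difference. The difference therefore depends only on the value of the section
at `x`. -/
lemma tensorialAt_nabla_sub_mvfderiv (x₀ : M) {x : M} (hx : x ∈ (chartAt E x₀).source)
    (v : TangentSpace 𝓘(ℝ, E) x) :
    TensorialAt 𝓘(ℝ, E) E (fun σ : ∀ x : M, TangentSpace 𝓘(ℝ, E) x ↦
      fibCoord x₀ ⟨x, nabla σ x v⟩
        - mvfderiv 𝓘(ℝ, E) (fun y ↦ fibCoord x₀ ⟨y, σ y⟩) x v) x where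
  smul {f σ} hf hσ := by
    have hloc : (fun y ↦ fibCoord x₀ ⟨y, (f • σ) y⟩) =ᶠ[𝓝 x]
        f • (fun y ↦ fibCoord x₀ ⟨y, σ y⟩) := by
      filter_upwards [(chartAt E x₀).open_source.mem_nhds hx] with y hy
      exact fibCoord_smul x₀ hy (f y) (σ y)
    simp only [nabla.isCovariantDerivativeOn.leibniz hσ hf, mvfderiv_congr hloc,
      mvfderiv_smul hf (mdifferentiableAt_fibCoord_section x₀ hx hσ)]
    simp [fibCoord_add x₀ hx, fibCoord_smul x₀ hx, smul_sub]
  add {σ σ'} hσ hσ' := by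
    have hloc : (fun y ↦ fibCoord x₀ ⟨y, (σ + σ') y⟩) =ᶠ[𝓝 x]
        (fun y ↦ fibCoord x₀ ⟨y, σ y⟩) + (fun y ↦ fibCoord x₀ ⟨y, σ' y⟩) := by
      filter_upwards [(chartAt E x₀).open_source.mem_nhds hx] with y hy
      exact fibCoord_add x₀ hy (σ y) (σ' y)
    simp only [nabla.isCovariantDerivativeOn.add hσ hσ', mvfderiv_congr hloc,
      mvfderiv_add (mdifferentiableAt_fibCoord_section x₀ hx hσ) (mdifferentiableAt_fibCoord_section x₀ hx hσ')]
    simp [fibCoord_add x₀ hx]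
    abel

/-- The components at `x` of `∇_v s`, where `s` is the section with constant components `w` in the
trivialization of `TM` at `x₀`. -/
def christoffelCoord (x₀ x : M) (v : TangentSpace 𝓘(ℝ, E) x) (w : E) : E :=
  fibCoord x₀ ⟨x, nabla (constSection x₀ w) x v⟩

lemma mdifferentiableAt_constSection (x₀ : M) (w : E) {x : M} (hx : x ∈ (chartAt E x₀).source) :
    MDifferentiableAt 𝓘(ℝ, E) (𝓘(ℝ, E).prod 𝓘(ℝ, E))
      (fun y ↦ (⟨y, constSection x₀ w y⟩ : TangentBundle 𝓘(ℝ, E) M)) x :=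
  (contMDiffAt_constSection x₀ w hx).mdifferentiableAt (by simp)

lemma mvfderiv_fibCoord_constSection (x₀ : M) (w : E) {x : M}
    (hx : x ∈ (chartAt E x₀).source) :
    mvfderiv 𝓘(ℝ, E) (fun y ↦ fibCoord x₀ ⟨y, constSection x₀ w y⟩) x = 0 :=
  mvfderiv_eq_zero_of_eventuallyEq_const (c := w) <| by
    filter_upwards [(chartAt E x₀).open_source.mem_nhds hx] with y hy
    exact fibCoord_constSection x₀ hy w

variable [FiniteDimensional ℝ E]

/-- This is ∇_v σ = D_v σ + Γ(v, σ): by tensoriality σ may be replaced by the constant-component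
section with the same value at `x`, whose flat derivative vanishes. -/
lemma fibCoord_nabla (x₀ : M) {x : M} (hx : x ∈ (chartAt E x₀).source)
    {σ : ∀ x : M, TangentSpace 𝓘(ℝ, E) x}
    (hσ : MDifferentiableAt 𝓘(ℝ, E) (𝓘(ℝ, E).prod 𝓘(ℝ, E))
      (fun y ↦ (⟨y, σ y⟩ : TangentBundle 𝓘(ℝ, E) M)) x) (v : TangentSpace 𝓘(ℝ, E) x) :
    fibCoord x₀ ⟨x, nabla σ x v⟩ = mvfderiv 𝓘(ℝ, E) (fun y ↦ fibCoord x₀ ⟨y, σ y⟩) x v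
      + christoffelCoord nabla x₀ x v (fibCoord x₀ ⟨x, σ x⟩) := by
  have h := (tensorialAt_nabla_sub_mvfderiv nabla x₀ hx v).pointwise hσ
    (mdifferentiableAt_constSection x₀ (fibCoord x₀ ⟨x, σ x⟩) hx)
    (constSection_fibCoord x₀ hx (σ x)).symm
  simp only [mvfderiv_fibCoord_constSection x₀ _ hx] at h
  rw [christoffelCoord, ← sub_eq_iff_eq_add', h]
  simp

omit [FiniteDimensional ℝ E] in
lemma constSection_eq_symmₗ (x₀ : M) (w : E) {x : M} (hx : x ∈ (chartAt E x₀).source) :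
    constSection x₀ w x =
      (trivializationAt E (fun x : M ↦ TangentSpace 𝓘(ℝ, E) x) x₀).symmₗ ℝ x w :=
  (Trivialization.symmₗ_apply (R := ℝ) _ (by exact hx) w).symm

omit [FiniteDimensional ℝ E] in
lemma constSection_add (x₀ : M) (w w' : E) {x : M} (hx : x ∈ (chartAt E x₀).source) :
    constSection x₀ (w + w') x = constSection x₀ w x + constSection x₀ w' x := by
  simp only [constSection_eq_symmₗ x₀ _ hx, map_add]

omit [FiniteDimensional ℝ E] in
lemma constSection_smul (x₀ : M) (c : ℝ) (w : E) {x : M} (hx : x ∈ (chartAt E x₀).source) :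
    constSection x₀ (c • w) x = c • constSection x₀ w x := by
  simp only [constSection_eq_symmₗ x₀ _ hx, map_smul]

omit [FiniteDimensional ℝ E] in
lemma nabla_congr {σ σ' : ∀ x : M, TangentSpace 𝓘(ℝ, E) x} {x : M}
    (hσ : MDifferentiableAt 𝓘(ℝ, E) (𝓘(ℝ, E).prod 𝓘(ℝ, E))
      (fun y ↦ (⟨y, σ y⟩ : TangentBundle 𝓘(ℝ, E) M)) x)
    (h : ∀ᶠ y in 𝓝 x, σ y = σ' y) : nabla σ x = nabla σ' x := by
  refine nabla.isCovariantDerivativeOn.congr_of_eventuallyEq (s := Set.univ) hσ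
    (hσ.congr_of_eventuallyEq ?_) univ_mem h
  filter_upwards [h] with y hy
  rw [hy]

/-- For fixed `v`, the components of `∇_v s` depend linearly on the constant components of `s`. -/
def christoffelLin (x₀ : M) {x : M} (hx : x ∈ (chartAt E x₀).source)
    (v : TangentSpace 𝓘(ℝ, E) x) : E →ₗ[ℝ] E where
  toFun := christoffelCoord nabla x₀ x v
  map_add' w w' := by
    have h : nabla (constSection x₀ (w + w')) x =
        nabla (constSection x₀ w + constSection x₀ w') x :=
      nabla_congr nabla (mdifferentiableAt_constSection x₀ _ hx) <| by
        filter_upwards [(chartAt E x₀).open_source.mem_nhds hx] with y hy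
        exact constSection_add x₀ w w' hy
    rw [christoffelCoord, h, nabla.isCovariantDerivativeOn.add
      (mdifferentiableAt_constSection x₀ w hx) (mdifferentiableAt_constSection x₀ w' hx)]
    exact fibCoord_add x₀ hx _ _
  map_smul' c w := by
    have h : nabla (constSection x₀ (c • w)) x = nabla (c • constSection x₀ w) x :=
      nabla_congr nabla (mdifferentiableAt_constSection x₀ _ hx) <| by
        filter_upwards [(chartAt E x₀).open_source.mem_nhds hx] with y hy
        exact constSection_smul x₀ c w hy
    rw [christoffelCoord, h, nabla.isCovariantDerivativeOn.smul_const c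
      (mdifferentiableAt_constSection x₀ w hx)]
    exact fibCoord_smul x₀ hx _ _

/-- Separates the fibre variable from the base point: smoothness is known in the base point for each
fixed `w`, and this expansion yields joint smoothness on TM. -/
lemma christoffelCoord_eq_sum (x₀ : M) {x : M} (hx : x ∈ (chartAt E x₀).source)
    (v : TangentSpace 𝓘(ℝ, E) x) (w : E) :
    christoffelCoord nabla x₀ x v w = ∑ i, (Module.finBasis ℝ E).repr w i •
      christoffelCoord nabla x₀ x v (Module.finBasis ℝ E i) := by
  conv_lhs => rw [← (Module.finBasis ℝ E).sum_repr w]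
  have h := map_sum (christoffelLin nabla x₀ hx v)
    (fun i ↦ (Module.finBasis ℝ E).repr w i • Module.finBasis ℝ E i) Finset.univ
  simp only [map_smul] at h
  exact h

lemma exists_isSmoothField_eventuallyEq_constSection [T2Space M] (x : M) (w : E) :
    ∃ σ : ∀ y : M, TangentSpace 𝓘(ℝ, E) y, IsSmoothField σ ∧
      ∀ᶠ y in 𝓝 x, σ y = constSection x w y := by
  obtain ⟨f⟩ : Nonempty (SmoothBumpFunction 𝓘(ℝ, E) x) := inferInstance
  refine ⟨(f : M → ℝ) • constSection x w, ?_, ?_⟩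
  · refine ContMDiffOn.smul_section_of_tsupport (u := (chartAt E x).source) ?_
      (chartAt E x).open_source f.tsupport_subset_chartAt_source ?_
    · exact f.contMDiff.contMDiffOn
    · exact fun y hy ↦ (contMDiffAt_constSection x w hy).contMDiffWithinAt
  · filter_upwards [f.eventuallyEq_one] with z hz
    simp [hz]

/-- Smoothness of ∇ is applied to a global smooth section, so the local constant-component section
is first cut off by a bump function; ∇ is local, hence unchanged near `x`. -/
lemma contMDiffAt_christoffelCoord [T2Space M]
    (hnabla : CovariantDerivative.ContMDiffCovariantDerivative nabla ∞) (x : M)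
    {X : ∀ x : M, TangentSpace 𝓘(ℝ, E) x}
    (hX : ContMDiffAt 𝓘(ℝ, E) (𝓘(ℝ, E).prod 𝓘(ℝ, E)) ∞
      (fun y ↦ (⟨y, X y⟩ : TangentBundle 𝓘(ℝ, E) M)) x) (w : E) :
    ContMDiffAt 𝓘(ℝ, E) 𝓘(ℝ, E) ∞ (fun y ↦ christoffelCoord nabla x y (X y) w) x := by
  obtain ⟨σ, hσ, hσx⟩ := exists_isSmoothField_eventuallyEq_constSection (E := E) x w
  have hσ' : ContMDiff 𝓘(ℝ, E) (𝓘(ℝ, E).prod 𝓘(ℝ, E)) (∞ + 1)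
      (fun y ↦ (⟨y, σ y⟩ : TangentBundle 𝓘(ℝ, E) M)) := hσ
  have h1 := (hnabla.contMDiff.contMDiff hσ'.contMDiffOn).contMDiffAt (x := x) univ_mem
  have h2 := h1.clm_bundle_apply hX
  have h3 := (contMDiffAt_section_iff_fibCoord x _ (mem_chart_source E x)).1 h2
  refine h3.congr_of_eventuallyEq ?_
  filter_upwards [(chartAt E x).open_source.mem_nhds (mem_chart_source E x),
    eventually_eventually_nhds.2 hσx] with y hy hf
  have : nabla σ y = nabla (constSection x w) y :=
    nabla_congr nabla ((hσ y).mdifferentiableAt (by simp)) hf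
  rw [christoffelCoord, ← this]

end Connection

/-! ### Horizontal and vertical lifts in coordinates -/

section LiftCoordinates

variable {E : Type*} [NormedAddCommGroup E] [NormedSpace ℝ E]
  {M : Type*} [TopologicalSpace M] [ChartedSpace E M] [IsManifold 𝓘(ℝ, E) ∞ M]
  (nabla : CovariantDerivative 𝓘(ℝ, E) E (fun x : M ↦ TangentSpace 𝓘(ℝ, E) x))

lemma mdifferentiableAt_extend_self (u : TangentBundle 𝓘(ℝ, E) M) :
    MDifferentiableAt 𝓘(ℝ, E) (𝓘(ℝ, E).prod 𝓘(ℝ, E))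
      (fun x : M ↦ (⟨x, FiberBundle.extend E u.2 x⟩ : TangentBundle 𝓘(ℝ, E) M)) u.1 :=
  FiberBundle.mdifferentiableAt_extend 𝓘(ℝ, E) E u.2

lemma projDeriv_sectionDeriv (u : TangentBundle 𝓘(ℝ, E) M) (v : TangentSpace 𝓘(ℝ, E) u.1) :
    projDeriv u (sectionDeriv u v) = v := by
  have hu : (⟨u.1, FiberBundle.extend E u.2 u.1⟩ : TangentBundle 𝓘(ℝ, E) M) = u := by simp
  have h := mfderiv_comp_apply_of_eq (I := 𝓘(ℝ, E)) (I' := 𝓘(ℝ, E).prod 𝓘(ℝ, E))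
    (I'' := 𝓘(ℝ, E)) (g := fun z : TangentBundle 𝓘(ℝ, E) M ↦ z.1) u.1
    ((contMDiff_bundleProj u).mdifferentiableAt (by simp)) (mdifferentiableAt_extend_self u) hu v
  exact h.symm.trans (congrArg (fun L : E →L[ℝ] E ↦ L v) (mfderiv_id (I := 𝓘(ℝ, E)) (x := u.1)))

lemma projDeriv_horLift (u : TangentBundle 𝓘(ℝ, E) M) (v : TangentSpace 𝓘(ℝ, E) u.1) :
    projDeriv u (horLift nabla u v) = v := by
  have h : horLift nabla u v = sectionDeriv u v - vertLift u (christoffel nabla u v) := rfl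
  rw [h, map_sub, projDeriv_sectionDeriv, projDeriv_vertLift, sub_zero]

variable [FiniteDimensional ℝ E]

/-- The flat derivative of the section through `u` minus the components of its covariant derivative
leaves -Γ. The chart centre `x₀` is kept independent of `u` because the lift at each point is
defined with the chart of that point, while smoothness and brackets need one fixed chart. -/
lemma mvfderiv_fibCoord_horLift (x₀ : M) (u : TangentBundle 𝓘(ℝ, E) M)
    (hu : u.1 ∈ (chartAt E x₀).source) (v : TangentSpace 𝓘(ℝ, E) u.1) :
    mvfderiv (𝓘(ℝ, E).prod 𝓘(ℝ, E)) (fibCoord x₀) u (horLift nabla u v) =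
      -christoffelCoord nabla x₀ u.1 v (fibCoord x₀ u) := by
  have h : horLift nabla u v = sectionDeriv u v - vertLift u (christoffel nabla u v) := rfl
  have hext := mdifferentiableAt_extend_self u
  have hu' : (⟨u.1, FiberBundle.extend E u.2 u.1⟩ : TangentBundle 𝓘(ℝ, E) M) = u := by simp
  have h1 := fibCoord_nabla nabla x₀ hu hext v
  have h2 : mvfderiv 𝓘(ℝ, E) (fun x ↦ fibCoord x₀ ⟨x, FiberBundle.extend E u.2 x⟩) u.1 v =
      mvfderiv (𝓘(ℝ, E).prod 𝓘(ℝ, E)) (fibCoord x₀) u (sectionDeriv u v) :=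
    mfderiv_comp_apply_of_eq (I := 𝓘(ℝ, E)) (I' := 𝓘(ℝ, E).prod 𝓘(ℝ, E))
      (I'' := 𝓘(ℝ, E)) (g := fibCoord x₀) u.1
      ((contMDiffAt_fibCoord x₀ hu).mdifferentiableAt (by simp)) hext hu' v
  rw [h, map_sub, mvfderiv_fibCoord_vertLift x₀ u hu, ← h2]
  rw [hu'] at h1
  have h3 : fibCoord x₀ ⟨u.1, christoffel nabla u v⟩ = _ := h1
  rw [h3]
  abel

omit [FiniteDimensional ℝ E] in
lemma connMap_vertLift (u : TangentBundle 𝓘(ℝ, E) M) (w : TangentSpace 𝓘(ℝ, E) u.1) :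
    connMap nabla u (vertLift u w) = w := by
  have h : connMap nabla u (vertLift u w) = fibreDeriv u (vertLift u w) +
    christoffel nabla u (projDeriv u (vertLift u w)) := rfl
  rw [h, projDeriv_vertLift, map_zero, add_zero, fibreDeriv_eq,
    mvfderiv_fibCoord_vertLift u.1 u (mem_chart_source E u.1), fibCoord_self]

lemma connMap_horLift (u : TangentBundle 𝓘(ℝ, E) M) (v : TangentSpace 𝓘(ℝ, E) u.1) :
    connMap nabla u (horLift nabla u v) = 0 := by
  have h : connMap nabla u (horLift nabla u v) = fibreDeriv u (horLift nabla u v) +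
    christoffel nabla u (projDeriv u (horLift nabla u v)) := rfl
  rw [h, projDeriv_horLift, fibreDeriv_eq,
    mvfderiv_fibCoord_horLift nabla u.1 u (mem_chart_source E u.1), christoffelCoord,
    fibCoord_self]
  have h2 : FiberBundle.extend E u.2 = constSection u.1 (fibCoord u.1 u) :=
    (extend_eq_constSection u.1 u.2).trans (by rw [← fibCoord_self u.1 u.2])
  rw [christoffel, h2]
  exact neg_add_cancel _

end LiftCoordinates

/-! ### Smoothness and Lie brackets of lifted fields -/

section LiftedFields

variable {E : Type*} [NormedAddCommGroup E] [NormedSpace ℝ E]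
  {M : Type*} [TopologicalSpace M] [ChartedSpace E M] [IsManifold 𝓘(ℝ, E) ∞ M]
  (nabla : CovariantDerivative 𝓘(ℝ, E) E (fun x : M ↦ TangentSpace 𝓘(ℝ, E) x))

lemma eventually_proj {p : M → Prop} (u : TangentBundle 𝓘(ℝ, E) M)
    (h : ∀ᶠ x in 𝓝 u.1, p x) : ∀ᶠ z : TangentBundle 𝓘(ℝ, E) M in 𝓝 u, p z.1 :=
  (contMDiff_bundleProj (E := E) (M := M)).continuous.continuousAt.eventually h

lemma eventually_proj_mem_source (u : TangentBundle 𝓘(ℝ, E) M) :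
    ∀ᶠ z : TangentBundle 𝓘(ℝ, E) M in 𝓝 u, z.1 ∈ (chartAt E u.1).source :=
  eventually_proj u ((chartAt E u.1).open_source.mem_nhds (mem_chart_source E u.1))

lemma contMDiffAt_fibCoord_comp_proj {X : ∀ x : M, TangentSpace 𝓘(ℝ, E) x}
    (u : TangentBundle 𝓘(ℝ, E) M)
    (hX : ContMDiffAt 𝓘(ℝ, E) (𝓘(ℝ, E).prod 𝓘(ℝ, E)) ∞
      (fun y ↦ (⟨y, X y⟩ : TangentBundle 𝓘(ℝ, E) M)) u.1) :
    ContMDiffAt (𝓘(ℝ, E).prod 𝓘(ℝ, E)) 𝓘(ℝ, E) ∞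
      (fun z : TangentBundle 𝓘(ℝ, E) M ↦ fibCoord u.1 ⟨z.1, X z.1⟩) u :=
  ((contMDiffAt_section_iff_fibCoord u.1 X (mem_chart_source E u.1)).1 hX).comp u
    (contMDiff_bundleProj u)

lemma vertLift_chart (X : ∀ x : M, TangentSpace 𝓘(ℝ, E) x) (u : TangentBundle 𝓘(ℝ, E) M) :
    (fun z ↦ mvfderiv (𝓘(ℝ, E).prod 𝓘(ℝ, E)) (extChartAt (𝓘(ℝ, E).prod 𝓘(ℝ, E)) u) z
      (vertLift z (X z.1))) =ᶠ[𝓝 u] fun z ↦ ((0 : E), fibCoord u.1 ⟨z.1, X z.1⟩) := by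
  filter_upwards [eventually_proj_mem_source u] with z hz
  rw [mvfderiv_extChartAt_tangentBundle u z hz, projDeriv_vertLift, fibCoord_zero u.1 hz,
    mvfderiv_fibCoord_vertLift u.1 z hz]

lemma contMDiffAt_vertLift {X : ∀ x : M, TangentSpace 𝓘(ℝ, E) x} (u : TangentBundle 𝓘(ℝ, E) M)
    (hX : ContMDiffAt 𝓘(ℝ, E) (𝓘(ℝ, E).prod 𝓘(ℝ, E)) ∞
      (fun y ↦ (⟨y, X y⟩ : TangentBundle 𝓘(ℝ, E) M)) u.1) :
    ContMDiffAt (𝓘(ℝ, E).prod 𝓘(ℝ, E)) 𝓘(ℝ, E × E) ∞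
      (fun z ↦ mvfderiv (𝓘(ℝ, E).prod 𝓘(ℝ, E)) (extChartAt (𝓘(ℝ, E).prod 𝓘(ℝ, E)) u) z
        (vertLift z (X z.1))) u :=
  (contMDiffAt_const.prodMk_space (contMDiffAt_fibCoord_comp_proj u hX)).congr_of_eventuallyEq
    (vertLift_chart X u)

lemma IsSmoothField.vertLift {X : ∀ x : M, TangentSpace 𝓘(ℝ, E) x} (hX : IsSmoothField X) :
    IsSmoothFieldTM (fun u ↦ vertLift u (X u.1)) :=
  fun u ↦ (contMDiffAt_field_iff _ u).2 (contMDiffAt_vertLift u (hX u.1))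

variable [FiniteDimensional ℝ E]

lemma horLift_chart (X : ∀ x : M, TangentSpace 𝓘(ℝ, E) x) (u : TangentBundle 𝓘(ℝ, E) M) :
    (fun z ↦ mvfderiv (𝓘(ℝ, E).prod 𝓘(ℝ, E)) (extChartAt (𝓘(ℝ, E).prod 𝓘(ℝ, E)) u) z
      (horLift nabla z (X z.1))) =ᶠ[𝓝 u] fun z ↦ (fibCoord u.1 ⟨z.1, X z.1⟩,
        -christoffelCoord nabla u.1 z.1 (X z.1) (fibCoord u.1 z)) := by
  filter_upwards [eventually_proj_mem_source u] with z hz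
  rw [mvfderiv_extChartAt_tangentBundle u z hz, projDeriv_horLift,
    mvfderiv_fibCoord_horLift nabla u.1 z hz]

lemma contMDiffAt_christoffelCoord_fibCoord [T2Space M]
    (hnabla : CovariantDerivative.ContMDiffCovariantDerivative nabla ∞)
    {X : ∀ x : M, TangentSpace 𝓘(ℝ, E) x} (u : TangentBundle 𝓘(ℝ, E) M)
    (hX : ContMDiffAt 𝓘(ℝ, E) (𝓘(ℝ, E).prod 𝓘(ℝ, E)) ∞
      (fun y ↦ (⟨y, X y⟩ : TangentBundle 𝓘(ℝ, E) M)) u.1) :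
    ContMDiffAt (𝓘(ℝ, E).prod 𝓘(ℝ, E)) 𝓘(ℝ, E) ∞
      (fun z : TangentBundle 𝓘(ℝ, E) M ↦
        christoffelCoord nabla u.1 z.1 (X z.1) (fibCoord u.1 z)) u := by
  have h : ContMDiffAt (𝓘(ℝ, E).prod 𝓘(ℝ, E)) 𝓘(ℝ, E) ∞
      (fun z : TangentBundle 𝓘(ℝ, E) M ↦ ∑ i, (Module.finBasis ℝ E).coord i (fibCoord u.1 z) •
        christoffelCoord nabla u.1 z.1 (X z.1) (Module.finBasis ℝ E i)) u := by
    refine contMDiffAt_finsetSum fun i _ ↦ ?_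
    have h1 : ContMDiffAt (𝓘(ℝ, E).prod 𝓘(ℝ, E)) 𝓘(ℝ, ℝ) ∞
        (fun z : TangentBundle 𝓘(ℝ, E) M ↦ (Module.finBasis ℝ E).coord i (fibCoord u.1 z)) u :=
      (LinearMap.toContinuousLinearMap
        ((Module.finBasis ℝ E).coord i)).contMDiff.contMDiffAt.comp u
        (contMDiffAt_fibCoord u.1 (mem_chart_source E u.1))
    have h2 : ContMDiffAt (𝓘(ℝ, E).prod 𝓘(ℝ, E)) 𝓘(ℝ, E) ∞
        (fun z : TangentBundle 𝓘(ℝ, E) M ↦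
          christoffelCoord nabla u.1 z.1 (X z.1) (Module.finBasis ℝ E i)) u :=
      (contMDiffAt_christoffelCoord nabla hnabla u.1 hX (Module.finBasis ℝ E i)).comp u
        (contMDiff_bundleProj u)
    exact h1.smul h2
  refine h.congr_of_eventuallyEq ?_
  filter_upwards [eventually_proj_mem_source u] with z hz
  exact christoffelCoord_eq_sum nabla u.1 hz (X z.1) (fibCoord u.1 z)

lemma contMDiffAt_horLift [T2Space M]
    (hnabla : CovariantDerivative.ContMDiffCovariantDerivative nabla ∞)
    {X : ∀ x : M, TangentSpace 𝓘(ℝ, E) x} (u : TangentBundle 𝓘(ℝ, E) M)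
    (hX : ContMDiffAt 𝓘(ℝ, E) (𝓘(ℝ, E).prod 𝓘(ℝ, E)) ∞
      (fun y ↦ (⟨y, X y⟩ : TangentBundle 𝓘(ℝ, E) M)) u.1) :
    ContMDiffAt (𝓘(ℝ, E).prod 𝓘(ℝ, E)) 𝓘(ℝ, E × E) ∞
      (fun z ↦ mvfderiv (𝓘(ℝ, E).prod 𝓘(ℝ, E)) (extChartAt (𝓘(ℝ, E).prod 𝓘(ℝ, E)) u) z
        (horLift nabla z (X z.1))) u :=
  ((contMDiffAt_fibCoord_comp_proj u hX).prodMk_space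
    (contMDiffAt_christoffelCoord_fibCoord nabla hnabla u hX).neg).congr_of_eventuallyEq
    (horLift_chart nabla X u)

lemma IsSmoothField.horLift [T2Space M]
    (hnabla : CovariantDerivative.ContMDiffCovariantDerivative nabla ∞)
    {X : ∀ x : M, TangentSpace 𝓘(ℝ, E) x} (hX : IsSmoothField X) :
    IsSmoothFieldTM (fun u ↦ horLift nabla u (X u.1)) :=
  fun u ↦ (contMDiffAt_field_iff _ u).2 (contMDiffAt_horLift nabla hnabla u (hX u.1))

/-- Along a fibre the base point is fixed and Γ(X, y) is linear in y, so its derivative in direction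
`w` is Γ(X, w). -/
lemma mvfderiv_christoffelCoord_vertLift [T2Space M]
    (hnabla : CovariantDerivative.ContMDiffCovariantDerivative nabla ∞)
    {X : ∀ x : M, TangentSpace 𝓘(ℝ, E) x} (u : TangentBundle 𝓘(ℝ, E) M)
    (hX : ContMDiffAt 𝓘(ℝ, E) (𝓘(ℝ, E).prod 𝓘(ℝ, E)) ∞
      (fun y ↦ (⟨y, X y⟩ : TangentBundle 𝓘(ℝ, E) M)) u.1) (w : TangentSpace 𝓘(ℝ, E) u.1) :
    mvfderiv (𝓘(ℝ, E).prod 𝓘(ℝ, E)) (fun z : TangentBundle 𝓘(ℝ, E) M ↦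
        christoffelCoord nabla u.1 z.1 (X z.1) (fibCoord u.1 z)) u (vertLift u w) =
      christoffelCoord nabla u.1 u.1 (X u.1) w := by
  have h := mvfderiv_comp_mfderiv_apply (I := 𝓘(ℝ, E)) (I' := 𝓘(ℝ, E).prod 𝓘(ℝ, E))
    (g := fun z : TangentBundle 𝓘(ℝ, E) M ↦
        christoffelCoord nabla u.1 z.1 (X z.1) (fibCoord u.1 z))
    (f := fun w : E ↦ (⟨u.1, w⟩ : TangentBundle 𝓘(ℝ, E) M)) u.2
    ((contMDiffAt_christoffelCoord_fibCoord nabla hnabla u hX).mdifferentiableAt (by simp))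
    ((contMDiff_fibreInclusion u.1 _).mdifferentiableAt (by simp)) w
  refine h.symm.trans ?_
  let L : E →L[ℝ] E := LinearMap.toContinuousLinearMap
    (christoffelLin nabla u.1 (mem_chart_source E u.1) (X u.1))
  have e : (fun w : E ↦ christoffelCoord nabla u.1 u.1 (X u.1)
      (fibCoord u.1 (⟨u.1, w⟩ : TangentBundle 𝓘(ℝ, E) M))) = L :=
    funext fun w ↦ congrArg (christoffelCoord nabla u.1 u.1 (X u.1)) (fibCoord_self u.1 w)
  rw [e]
  exact (mvfderiv_vectorSpace _ _ _).trans (congrArg (fun K : E →L[ℝ] E ↦ K w) L.fderiv)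

omit [FiniteDimensional ℝ E] in
lemma mvfderiv_extChartAt_tangentBundle_injective (u : TangentBundle 𝓘(ℝ, E) M) :
    Function.Injective
      (mvfderiv (𝓘(ℝ, E).prod 𝓘(ℝ, E)) (extChartAt (𝓘(ℝ, E).prod 𝓘(ℝ, E)) u) u) := by
  have hid : ∀ w : TangentSpace (𝓘(ℝ, E).prod 𝓘(ℝ, E)) u,
      mvfderiv (𝓘(ℝ, E).prod 𝓘(ℝ, E)) (extChartAt (𝓘(ℝ, E).prod 𝓘(ℝ, E)) u) u w = w := fun w ↦
    congrArg (fun L : E × E →L[ℝ] E × E ↦ L w)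
      (mfderiv_extChartAt_self (I := 𝓘(ℝ, E).prod 𝓘(ℝ, E)) (x := u))
  intro v w h
  rwa [hid, hid] at h

omit [FiniteDimensional ℝ E] in
lemma mvfderiv_fibCoord_comp_proj {X : ∀ x : M, TangentSpace 𝓘(ℝ, E) x}
    (u : TangentBundle 𝓘(ℝ, E) M)
    (hX : ContMDiffAt 𝓘(ℝ, E) (𝓘(ℝ, E).prod 𝓘(ℝ, E)) ∞
      (fun y ↦ (⟨y, X y⟩ : TangentBundle 𝓘(ℝ, E) M)) u.1)
    (Z : TangentSpace (𝓘(ℝ, E).prod 𝓘(ℝ, E)) u) :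
    mvfderiv (𝓘(ℝ, E).prod 𝓘(ℝ, E)) (fun z ↦ fibCoord u.1 ⟨z.1, X z.1⟩) u Z =
      mvfderiv 𝓘(ℝ, E) (fun y ↦ fibCoord u.1 ⟨y, X y⟩) u.1 (projDeriv u Z) :=
  mvfderiv_comp_proj_apply (f := fun y ↦ fibCoord u.1 ⟨y, X y⟩) u
    (mdifferentiableAt_fibCoord_section u.1 (mem_chart_source E u.1)
      (hX.mdifferentiableAt (by simp))) Z

/-- `[X^h, Y^v] = (∇_X Y)^v`. -/
lemma mlieBracket_horLift_vertLift [T2Space M]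
    (hnabla : CovariantDerivative.ContMDiffCovariantDerivative nabla ∞)
    {X Y : ∀ x : M, TangentSpace 𝓘(ℝ, E) x} (u : TangentBundle 𝓘(ℝ, E) M)
    (hX : ContMDiffAt 𝓘(ℝ, E) (𝓘(ℝ, E).prod 𝓘(ℝ, E)) ∞
      (fun y ↦ (⟨y, X y⟩ : TangentBundle 𝓘(ℝ, E) M)) u.1)
    (hY : ContMDiffAt 𝓘(ℝ, E) (𝓘(ℝ, E).prod 𝓘(ℝ, E)) ∞
      (fun y ↦ (⟨y, Y y⟩ : TangentBundle 𝓘(ℝ, E) M)) u.1) :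
    VectorField.mlieBracket (𝓘(ℝ, E).prod 𝓘(ℝ, E)) (fun z ↦ horLift nabla z (X z.1))
      (fun z ↦ vertLift z (Y z.1)) u = vertLift u (nabla Y u.1 (X u.1)) := by
  apply mvfderiv_extChartAt_tangentBundle_injective u
  have hu := mem_chart_source E u.1
  have hΓ := (contMDiffAt_christoffelCoord_fibCoord nabla hnabla u hX).mdifferentiableAt
    (by simp : (∞ : ℕ∞ω) ≠ 0)
  have hΓ' : MDifferentiableAt (𝓘(ℝ, E).prod 𝓘(ℝ, E)) 𝓘(ℝ, E)
      (fun z : TangentBundle 𝓘(ℝ, E) M ↦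
        -christoffelCoord nabla u.1 z.1 (X z.1) (fibCoord u.1 z)) u := hΓ.neg
  have hXc := (contMDiffAt_fibCoord_comp_proj u hX).mdifferentiableAt (by simp : (∞ : ℕ∞ω) ≠ 0)
  have hYc := (contMDiffAt_fibCoord_comp_proj u hY).mdifferentiableAt (by simp : (∞ : ℕ∞ω) ≠ 0)
  rw [mvfderiv_extChartAt_mlieBracket _ _ u
    ((contMDiffAt_horLift nabla hnabla u hX).mdifferentiableAt (by simp))
    ((contMDiffAt_vertLift u hY).mdifferentiableAt (by simp)),
    mvfderiv_congr (vertLift_chart Y u), mvfderiv_congr (horLift_chart nabla X u),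
    mvfderiv_prodMk_apply mdifferentiableAt_const hYc, mvfderiv_prodMk_apply hXc hΓ',
    mvfderiv_fibCoord_comp_proj u hX, mvfderiv_fibCoord_comp_proj u hY, projDeriv_vertLift,
    projDeriv_horLift, mvfderiv_extChartAt_tangentBundle u u hu, projDeriv_vertLift,
    fibCoord_zero u.1 hu, mvfderiv_fibCoord_vertLift u.1 u hu, mvfderiv_const,
    fibCoord_nabla nabla u.1 hu (hY.mdifferentiableAt (by simp)), fibCoord_self]
  have hneg : ∀ Z, mvfderiv (𝓘(ℝ, E).prod 𝓘(ℝ, E)) (fun z : TangentBundle 𝓘(ℝ, E) M ↦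
      -christoffelCoord nabla u.1 z.1 (X z.1) (fibCoord u.1 z)) u Z =
      -mvfderiv (𝓘(ℝ, E).prod 𝓘(ℝ, E)) (fun z : TangentBundle 𝓘(ℝ, E) M ↦
      christoffelCoord nabla u.1 z.1 (X z.1) (fibCoord u.1 z)) u Z := fun Z ↦ by
    rw [mvfderiv_fun_neg]
    rfl
  -- The fibre component is now D_X Y + Γ(X, Y) on both sides; the base component is zero.
  rw [hneg, mvfderiv_christoffelCoord_vertLift nabla hnabla u hX]
  simp

omit [FiniteDimensional ℝ E] in
/-- `[X^v, Y^v] = 0`. -/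
lemma mlieBracket_vertLift_vertLift
    {X Y : ∀ x : M, TangentSpace 𝓘(ℝ, E) x} (u : TangentBundle 𝓘(ℝ, E) M)
    (hX : ContMDiffAt 𝓘(ℝ, E) (𝓘(ℝ, E).prod 𝓘(ℝ, E)) ∞
      (fun y ↦ (⟨y, X y⟩ : TangentBundle 𝓘(ℝ, E) M)) u.1)
    (hY : ContMDiffAt 𝓘(ℝ, E) (𝓘(ℝ, E).prod 𝓘(ℝ, E)) ∞
      (fun y ↦ (⟨y, Y y⟩ : TangentBundle 𝓘(ℝ, E) M)) u.1) :
    VectorField.mlieBracket (𝓘(ℝ, E).prod 𝓘(ℝ, E)) (fun z ↦ vertLift z (X z.1))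
      (fun z ↦ vertLift z (Y z.1)) u = 0 := by
  apply mvfderiv_extChartAt_tangentBundle_injective u
  have hXc := (contMDiffAt_fibCoord_comp_proj u hX).mdifferentiableAt (by simp : (∞ : ℕ∞ω) ≠ 0)
  have hYc := (contMDiffAt_fibCoord_comp_proj u hY).mdifferentiableAt (by simp : (∞ : ℕ∞ω) ≠ 0)
  rw [mvfderiv_extChartAt_mlieBracket _ _ u
    ((contMDiffAt_vertLift u hX).mdifferentiableAt (by simp))
    ((contMDiffAt_vertLift u hY).mdifferentiableAt (by simp)),
    mvfderiv_congr (vertLift_chart Y u), mvfderiv_congr (vertLift_chart X u),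
    mvfderiv_prodMk_apply mdifferentiableAt_const hYc,
    mvfderiv_prodMk_apply mdifferentiableAt_const hXc,
    mvfderiv_fibCoord_comp_proj u hX, mvfderiv_fibCoord_comp_proj u hY, projDeriv_vertLift,
    projDeriv_vertLift, mvfderiv_const]
  simp

end LiftedFields

/-- Here 2σ - p is exactly √(p² + 4q). -/
lemma metallicMean_coeff_pos (p : ℕ) {q : ℕ} (hq : 0 < q) : 0 < (2 * metallicMean p q - p) / 2 := by
  have hq' : (0 : ℝ) < q := Nat.cast_pos.2 hq
  have h : 0 < √((p : ℝ) ^ 2 + 4 * q) := Real.sqrt_pos.2 (by positivity)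
  rw [metallicMean]
  linarith

lemma mvfderiv_eq_zero_of_eventually_eq_zero {E : Type*} [NormedAddCommGroup E] [NormedSpace ℝ E]
    {H : Type*} [TopologicalSpace H] {I : ModelWithCorners ℝ E H}
    {N : Type*} [TopologicalSpace N] [ChartedSpace H N] {f : N → ℝ} {x : N}
    (h : ∀ᶠ z in 𝓝 x, f z = 0) (v : TangentSpace I x) : mvfderiv I f x v = 0 := by
  rw [mvfderiv_eq_zero_of_eventuallyEq_const h]
  rfl

/-! ### The form Φ', P-Sasakian identities and the two coboundary computations -/

section Structure

variable {E : Type*} [NormedAddCommGroup E] [NormedSpace ℝ E] [FiniteDimensional ℝ E]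
  {M : Type*} [TopologicalSpace M] [ChartedSpace E M] [IsManifold 𝓘(ℝ, E) ∞ M]
  [RiemannianBundle (fun x : M ↦ TangentSpace 𝓘(ℝ, E) x)]
  {nabla : CovariantDerivative 𝓘(ℝ, E) E (fun x : M ↦ TangentSpace 𝓘(ℝ, E) x)}
  {phi : ∀ x : M, TangentSpace 𝓘(ℝ, E) x →L[ℝ] TangentSpace 𝓘(ℝ, E) x}
  {eta : ∀ x : M, TangentSpace 𝓘(ℝ, E) x →L[ℝ] ℝ}
  {xi : ∀ x : M, TangentSpace 𝓘(ℝ, E) x}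

lemma fundamentalForm_eq (p q : ℕ) (u : TangentBundle 𝓘(ℝ, E) M)
    (Z W : TangentSpace (𝓘(ℝ, E).prod 𝓘(ℝ, E)) u) :
    fundamentalForm nabla phi eta xi p q u Z W = -((2 * metallicMean p q - p) / 2) *
      (inner ℝ (projDeriv u Z) (phi u.1 (projDeriv u W) + eta u.1 (connMap nabla u W) • xi u.1)
      + inner ℝ (connMap nabla u Z)
        (phi u.1 (connMap nabla u W) + eta u.1 (projDeriv u W) • xi u.1)) := by
  have hF : metallicF nabla phi eta xi p q u W = ((p : ℝ) / 2) • W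
      - ((2 * metallicMean p q - p) / 2) •
        (horLift nabla u (phi u.1 (projDeriv u W)) + vertLift u (phi u.1 (connMap nabla u W))
          + eta u.1 (connMap nabla u W) • horLift nabla u (xi u.1)
          + eta u.1 (projDeriv u W) • vertLift u (xi u.1)) := rfl
  rw [fundamentalForm, sasakiMetric, sasakiMetric, hF]
  simp only [map_sub, map_add, map_smul, projDeriv_horLift, projDeriv_vertLift, connMap_horLift,
    connMap_vertLift, inner_sub_right, inner_add_right, inner_smul_right, smul_zero, add_zero,
    zero_add]
  ring

lemma fundamentalForm_vertLift_vertLift (p q : ℕ) (u : TangentBundle 𝓘(ℝ, E) M)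
    (a b : TangentSpace 𝓘(ℝ, E) u.1) :
    fundamentalForm nabla phi eta xi p q u (vertLift u a) (vertLift u b) =
      -((2 * metallicMean p q - p) / 2) * inner ℝ a (phi u.1 b) := by
  simp [fundamentalForm_eq, projDeriv_vertLift, connMap_vertLift]

lemma fundamentalForm_vertLift_horLift (p q : ℕ) (u : TangentBundle 𝓘(ℝ, E) M)
    (a b : TangentSpace 𝓘(ℝ, E) u.1) :
    fundamentalForm nabla phi eta xi p q u (vertLift u a) (horLift nabla u b) =
      -((2 * metallicMean p q - p) / 2) * (eta u.1 b * inner ℝ a (xi u.1)) := by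
  simp [fundamentalForm_eq, projDeriv_vertLift, connMap_vertLift, projDeriv_horLift,
    connMap_horLift, inner_smul_right]

lemma fundamentalForm_horLift_vertLift (p q : ℕ) (u : TangentBundle 𝓘(ℝ, E) M)
    (a b : TangentSpace 𝓘(ℝ, E) u.1) :
    fundamentalForm nabla phi eta xi p q u (horLift nabla u a) (vertLift u b) =
      -((2 * metallicMean p q - p) / 2) * (eta u.1 b * inner ℝ a (xi u.1)) := by
  simp [fundamentalForm_eq, projDeriv_vertLift, connMap_vertLift, projDeriv_horLift,
    connMap_horLift, inner_smul_right]

lemma fundamentalForm_zero_left (p q : ℕ) (u : TangentBundle 𝓘(ℝ, E) M)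
    (W : TangentSpace (𝓘(ℝ, E).prod 𝓘(ℝ, E)) u) :
    fundamentalForm nabla phi eta xi p q u 0 W = 0 := by
  simp [fundamentalForm_eq]

variable [IsContMDiffRiemannianBundle 𝓘(ℝ, E) ∞ E (fun x : M ↦ TangentSpace 𝓘(ℝ, E) x)]

lemma IsPSasakian.inner_xi (hM : IsPSasakian nabla phi eta xi) (x : M)
    (v : TangentSpace 𝓘(ℝ, E) x) : inner ℝ v (xi x) = eta x v := by
  rw [hM.metric, hM.phi_xi, inner_zero_right, hM.eta_xi, zero_add, mul_one]

lemma IsPSasakian.inner_phi_phi (hM : IsPSasakian nabla phi eta xi) (x : M)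
    (v : TangentSpace 𝓘(ℝ, E) x) :
    inner ℝ (phi x v) (phi x v) = (inner ℝ v v : ℝ) - eta x v * eta x v :=
  eq_sub_of_add_eq (hM.metric x v v).symm

/-- Differentiate g(ξ, ξ) = 1 using metric compatibility. -/
lemma IsPSasakian.eta_nabla_xi (hM : IsPSasakian nabla phi eta xi) (x : M)
    (v : TangentSpace 𝓘(ℝ, E) x) : eta x (nabla xi x v) = 0 := by
  have hxi := (hM.smooth_xi x).mdifferentiableAt (by simp)
  have h := hM.leviCivita.metric.mvfderiv_inner_eq (FiberBundle.extend E v) hxi hxi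
  have hc : (fun y ↦ inner ℝ (xi y) (xi y)) = fun _ : M ↦ (1 : ℝ) :=
    funext fun y ↦ (hM.inner_xi y (xi y)).trans (hM.eta_xi y)
  rw [hc, mvfderiv_const] at h
  have hcomm : (inner ℝ (xi x) (nabla xi x v) : ℝ) = eta x (nabla xi x v) :=
    (real_inner_comm _ _).trans (hM.inner_xi x _)
  simp only [FiberBundle.extend_apply_self, hM.inner_xi, hcomm, zero_apply] at h
  linarith

/-- `∇_v ξ = φ v`. -/
lemma IsPSasakian.nabla_xi (hM : IsPSasakian nabla phi eta xi) (x : M)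
    (v : TangentSpace 𝓘(ℝ, E) x) : nabla xi x v = phi x v := by
  -- With Y = ξ the term ∇_v(φξ) vanishes and the structure equation becomes φ(∇_v ξ) = v - η(v)ξ.
  have h := hM.nabla_phi x v xi hM.smooth_xi
  have hz : (fun y ↦ phi y (xi y)) = 0 := funext fun y ↦ hM.phi_xi y
  have hphi : phi x (nabla xi x v) = v - eta x v • xi x := by
    rw [hz, nabla.zero, hM.inner_xi, hM.eta_xi] at h
    have h' : -phi x (nabla xi x v) = -(eta x v) • xi x - v + (2 * eta x v) • xi x := by
      simpa using h
    rw [← neg_neg (phi x (nabla xi x v)), h']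
    module
  -- A second φ recovers ∇_v ξ, because it has no component along ξ.
  have h2 := hM.phi_phi x (nabla xi x v)
  rw [hphi, hM.eta_nabla_xi, map_sub, map_smul, hM.phi_xi] at h2
  simpa using h2.symm

/-- `3 dΦ'(X^h, X^v, ξ^v) = -((2σ - p) / 2) g(X, X)` for a field `X` with `η(X) = 0`. -/
lemma IsPSasakian.coboundary_horLift_vertLift_vertLift [T2Space M]
    (hM : IsPSasakian nabla phi eta xi) (p q : ℕ) {X : ∀ x : M, TangentSpace 𝓘(ℝ, E) x}
    (u : TangentBundle 𝓘(ℝ, E) M)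
    (hX : ContMDiffAt 𝓘(ℝ, E) (𝓘(ℝ, E).prod 𝓘(ℝ, E)) ∞
      (fun y ↦ (⟨y, X y⟩ : TangentBundle 𝓘(ℝ, E) M)) u.1)
    (heta : ∀ᶠ x in 𝓝 u.1, eta x (X x) = 0) :
    3 * coboundary (fundamentalForm nabla phi eta xi p q) (fun z ↦ horLift nabla z (X z.1))
      (fun z ↦ vertLift z (X z.1)) (fun z ↦ vertLift z (xi z.1)) u =
      -((2 * metallicMean p q - p) / 2) * inner ℝ (X u.1) (X u.1) := by
  have hnabla := hM.leviCivita.smooth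
  have hxi := hM.smooth_xi u.1
  have hev := eventually_proj u heta
  -- The coboundary contains [ξ^v, X^h]; the swap turns it into -[X^h, ξ^v] = -(φX)^v. The term with
  -- (∇_X X)^v drops out because φξ = 0.
  rw [coboundary, VectorField.mlieBracket_swap_apply (V := fun z ↦ vertLift z (xi z.1)),
    mlieBracket_horLift_vertLift nabla hnabla u hX hX,
    mlieBracket_horLift_vertLift nabla hnabla u hX hxi,
    mlieBracket_vertLift_vertLift u hX hxi, hM.nabla_xi, ← map_neg,
    mvfderiv_eq_zero_of_eventually_eq_zero
      (f := fun z ↦ fundamentalForm nabla phi eta xi p q z (vertLift z (X z.1))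
        (vertLift z (xi z.1))),
    mvfderiv_eq_zero_of_eventually_eq_zero
      (f := fun z ↦ fundamentalForm nabla phi eta xi p q z (vertLift z (xi z.1))
        (horLift nabla z (X z.1))),
    mvfderiv_eq_zero_of_eventually_eq_zero
      (f := fun z ↦ fundamentalForm nabla phi eta xi p q z (horLift nabla z (X z.1))
        (vertLift z (X z.1))),
    fundamentalForm_zero_left, fundamentalForm_vertLift_vertLift,
    fundamentalForm_vertLift_vertLift, hM.phi_xi, inner_neg_left, hM.inner_phi_phi,
    heta.self_of_nhds, inner_zero_right]
  · ring
  · filter_upwards [hev] with z hz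
    rw [fundamentalForm_horLift_vertLift, hz, zero_mul, mul_zero]
  · filter_upwards [hev] with z hz
    rw [fundamentalForm_vertLift_horLift, hz, zero_mul, mul_zero]
  · filter_upwards with z
    rw [fundamentalForm_vertLift_vertLift, hM.phi_xi, inner_zero_right, mul_zero]

lemma IsPSasakian.contMDiff_eta (hM : IsPSasakian nabla phi eta xi) :
    ContMDiff (𝓘(ℝ, E).prod 𝓘(ℝ, E)) 𝓘(ℝ, ℝ) ∞
      (fun z : TangentBundle 𝓘(ℝ, E) M ↦ eta z.1 z.2) := by
  intro u
  have h1 : ContMDiffAt (𝓘(ℝ, E).prod 𝓘(ℝ, E)) (𝓘(ℝ, E).prod 𝓘(ℝ, E →L[ℝ] ℝ)) ∞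
      (fun z : TangentBundle 𝓘(ℝ, E) M ↦ TotalSpace.mk' (E →L[ℝ] ℝ)
        (E := fun x : M ↦ TangentSpace 𝓘(ℝ, E) x →L[ℝ] Bundle.Trivial M ℝ x) z.1 (eta z.1)) u :=
    (hM.smooth_eta u.1).comp u (contMDiff_bundleProj u)
  have h2 : ContMDiffAt (𝓘(ℝ, E).prod 𝓘(ℝ, E)) (𝓘(ℝ, E).prod 𝓘(ℝ, E)) ∞
    (fun z : TangentBundle 𝓘(ℝ, E) M ↦ (⟨z.1, z.2⟩ : TangentBundle 𝓘(ℝ, E) M)) u := contMDiffAt_id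
  have h3 := ContMDiffAt.clm_bundle_apply (b := fun z : TangentBundle 𝓘(ℝ, E) M ↦ z.1)
    (E₂ := Bundle.Trivial M ℝ) h1 h2
  exact (contMDiffAt_totalSpace.1 h3).2

lemma IsPSasakian.contMDiff_eta_field (hM : IsPSasakian nabla phi eta xi)
    {X : ∀ x : M, TangentSpace 𝓘(ℝ, E) x} (hX : IsSmoothField X) :
    ContMDiff 𝓘(ℝ, E) 𝓘(ℝ, ℝ) ∞ (fun x ↦ eta x (X x)) :=
  hM.contMDiff_eta.comp hX

lemma IsPSasakian.mvfderiv_eta_vertLift (hM : IsPSasakian nabla phi eta xi)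
    (u : TangentBundle 𝓘(ℝ, E) M) (w : TangentSpace 𝓘(ℝ, E) u.1) :
    mvfderiv (𝓘(ℝ, E).prod 𝓘(ℝ, E)) (fun z : TangentBundle 𝓘(ℝ, E) M ↦ eta z.1 z.2) u
      (vertLift u w) = eta u.1 w := by
  have h := mvfderiv_comp_mfderiv_apply (I := 𝓘(ℝ, E)) (I' := 𝓘(ℝ, E).prod 𝓘(ℝ, E))
    (g := fun z : TangentBundle 𝓘(ℝ, E) M ↦ eta z.1 z.2)
    (f := fun w : E ↦ (⟨u.1, w⟩ : TangentBundle 𝓘(ℝ, E) M)) u.2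
    ((hM.contMDiff_eta u).mdifferentiableAt (by simp))
    ((contMDiff_fibreInclusion u.1 _).mdifferentiableAt (by simp)) w
  refine h.symm.trans ?_
  let L : E →L[ℝ] ℝ := eta u.1
  exact (mvfderiv_vectorSpace L _ _).trans (congrArg (fun K : E →L[ℝ] ℝ ↦ K w) L.fderiv)

/-- If `η(v) = 0`, then `v` extends to a smooth vector field `X` on `M` with `η(X) = 0`. -/
lemma IsPSasakian.exists_field_eta_eq_zero [T2Space M] (hM : IsPSasakian nabla phi eta xi) (x : M)
    {v : TangentSpace 𝓘(ℝ, E) x} (hv : eta x v = 0) :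
    ∃ X : ∀ x : M, TangentSpace 𝓘(ℝ, E) x,
      IsSmoothField X ∧ (∀ y, eta y (X y) = 0) ∧ X x = v := by
  obtain ⟨Y, hY, hYx⟩ := exists_isSmoothField_eventuallyEq_constSection x (fibCoord x ⟨x, v⟩)
  have hYv : Y x = v :=
    hYx.self_of_nhds.trans (constSection_fibCoord x (mem_chart_source E x) v)
  -- Projecting a global extension of `v` onto ker η along ξ does not change its value at `x`, as
  -- η(v) = 0.
  refine ⟨fun y ↦ Y y - eta y (Y y) • xi y, ?_, fun y ↦ ?_, ?_⟩
  · exact ContMDiff.sub_section hY ((hM.contMDiff_eta_field hY).smul_section hM.smooth_xi)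
  · rw [map_sub, map_smul, hM.eta_xi, smul_eq_mul, mul_one, sub_self]
  · change Y x - eta x (Y x) • xi x = v
    rw [hYv, hv, zero_smul, sub_zero]

/-- `3 dΦ'(η ξ^v, ξ^v, ξ^h) = -(2σ - p)`, where `η` is regarded as a function on `TM`. -/
lemma IsPSasakian.coboundary_smul_vertLift_vertLift_horLift [T2Space M]
    (hM : IsPSasakian nabla phi eta xi) (p q : ℕ) (u : TangentBundle 𝓘(ℝ, E) M) :
    3 * coboundary (fundamentalForm nabla phi eta xi p q)
      ((fun z : TangentBundle 𝓘(ℝ, E) M ↦ eta z.1 z.2) • fun z ↦ vertLift z (xi z.1))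
      (fun z ↦ vertLift z (xi z.1)) (fun z ↦ horLift nabla z (xi z.1)) u =
      -(2 * metallicMean p q - p) := by
  have hnabla := hM.leviCivita.smooth
  have hxi := hM.smooth_xi u.1
  have hf := (hM.contMDiff_eta u).mdifferentiableAt (by simp : (∞ : ℕ∞ω) ≠ 0)
  have hV := (hM.smooth_xi.vertLift u).mdifferentiableAt (by simp : (∞ : ℕ∞ω) ≠ 0)
  have hhv : VectorField.mlieBracket (𝓘(ℝ, E).prod 𝓘(ℝ, E)) (fun z ↦ horLift nabla z (xi z.1))
      (fun z ↦ vertLift z (xi z.1)) u = 0 := by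
    rw [mlieBracket_horLift_vertLift nabla hnabla u hxi hxi, hM.nabla_xi, hM.phi_xi, map_zero]
  have hvh : VectorField.mlieBracket (𝓘(ℝ, E).prod 𝓘(ℝ, E)) (fun z ↦ vertLift z (xi z.1))
      (fun z ↦ horLift nabla z (xi z.1)) u = 0 := by
    rw [VectorField.mlieBracket_swap_apply, hhv, neg_zero]
  have hsmul_left : ∀ (c : ℝ) (z : TangentBundle 𝓘(ℝ, E) M)
      (Z W : TangentSpace (𝓘(ℝ, E).prod 𝓘(ℝ, E)) z),
      fundamentalForm nabla phi eta xi p q z (c • Z) W =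
        c * fundamentalForm nabla phi eta xi p q z Z W := by
    intro c z Z W
    simp only [fundamentalForm_eq, map_smul, inner_smul_left, RCLike.conj_to_real]
    ring
  have hsmul_right : ∀ (c : ℝ) (z : TangentBundle 𝓘(ℝ, E) M)
      (Z W : TangentSpace (𝓘(ℝ, E).prod 𝓘(ℝ, E)) z),
      fundamentalForm nabla phi eta xi p q z Z (c • W) =
        c * fundamentalForm nabla phi eta xi p q z Z W := by
    intro c z Z W
    simp only [fundamentalForm_eq, map_smul, smul_assoc, ← smul_add, inner_smul_right]
    ring
  have hvv : ∀ z : TangentBundle 𝓘(ℝ, E) M, fundamentalForm nabla phi eta xi p q z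
      (vertLift z (xi z.1)) (vertLift z (xi z.1)) = 0 := fun z ↦ by
    rw [fundamentalForm_vertLift_vertLift, hM.phi_xi, inner_zero_right, mul_zero]
  have hvh' : ∀ z : TangentBundle 𝓘(ℝ, E) M, fundamentalForm nabla phi eta xi p q z
      (vertLift z (xi z.1)) (horLift nabla z (xi z.1)) =
        -((2 * metallicMean p q - p) / 2) := fun z ↦ by
    rw [fundamentalForm_vertLift_horLift, hM.inner_xi, hM.eta_xi, mul_one, mul_one]
  have hhv' : ∀ z : TangentBundle 𝓘(ℝ, E) M, fundamentalForm nabla phi eta xi p q z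
      (horLift nabla z (xi z.1)) (vertLift z (xi z.1)) =
        -((2 * metallicMean p q - p) / 2) := fun z ↦ by
    rw [fundamentalForm_horLift_vertLift, hM.inner_xi, hM.eta_xi, mul_one, mul_one]
  -- The function η on TM is linear on fibres, so ξ^v differentiates it to η(ξ) = 1.
  have hd : mvfderiv (𝓘(ℝ, E).prod 𝓘(ℝ, E)) (fun z : TangentBundle 𝓘(ℝ, E) M ↦
      eta z.1 z.2 * -((2 * metallicMean p q - p) / 2)) u (vertLift u (xi u.1)) =
      -((2 * metallicMean p q - p) / 2) := by
    rw [mvfderiv_fun_mul hf mdifferentiableAt_const, mvfderiv_const]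
    simp [hM.mvfderiv_eta_vertLift, hM.eta_xi]
  -- With f = η, [f ξ^v, ξ^v] = -ξ^v contributes Φ'(ξ^v, ξ^h) = -c, with the same sign as the
  -- derivative of f Φ'(ξ^h, ξ^v). For a skew form these two would cancel. The bracket [ξ^h, f ξ^v]
  -- is a multiple of ξ^v and is paired with ξ^v, giving 0.
  rw [coboundary, VectorField.mlieBracket_smul_left hf hV, VectorField.mlieBracket_smul_right hf hV,
    hhv, hvh, mlieBracket_vertLift_vertLift u hxi hxi, hM.mvfderiv_eta_vertLift, hM.eta_xi]
  simp only [Pi.smul_apply', hsmul_left, hsmul_right, hvv, hvh', hhv', hd, smul_zero, add_zero,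
    mul_zero, mvfderiv_const, fundamentalForm_zero_left]
  simp
  ring

end Structure

end PSasakianLift

end

/-! ### The theorem -/

theorem mainTheorem6 {E : Type*} [NormedAddCommGroup E] [NormedSpace ℝ E] [FiniteDimensional ℝ E]
    {M : Type*} [TopologicalSpace M] [T2Space M] [SecondCountableTopology M] [Nonempty M]
    [ChartedSpace E M] [IsManifold 𝓘(ℝ, E) ∞ M]
    [RiemannianBundle (fun x : M ↦ TangentSpace 𝓘(ℝ, E) x)]
    [IsContMDiffRiemannianBundle 𝓘(ℝ, E) ∞ E (fun x : M ↦ TangentSpace 𝓘(ℝ, E) x)]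
    (nabla : CovariantDerivative 𝓘(ℝ, E) E (fun x : M ↦ TangentSpace 𝓘(ℝ, E) x))
    (phi : ∀ x : M, TangentSpace 𝓘(ℝ, E) x →L[ℝ] TangentSpace 𝓘(ℝ, E) x)
    (eta : ∀ x : M, TangentSpace 𝓘(ℝ, E) x →L[ℝ] ℝ)
    (xi : ∀ x : M, TangentSpace 𝓘(ℝ, E) x)
    (hM : PSasakianLift.IsPSasakian nabla phi eta xi)
    (p q : ℕ) (hp : 0 < p) (hq : 0 < q) :
    (¬ PSasakianLift.IsClosedForm
        (PSasakianLift.fundamentalForm nabla phi eta xi p q)) ∧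
    (∀ (U : Set M) (X : ∀ x : M, TangentSpace 𝓘(ℝ, E) x), IsOpen U →
      PSasakianLift.IsSmoothFieldOn U X →
      (∀ x ∈ U, eta x (X x) = 0 ∧ (inner ℝ (X x) (X x) : ℝ) = 1) →
      ∀ u : TangentBundle 𝓘(ℝ, E) M, u.1 ∈ U →
        PSasakianLift.coboundary (PSasakianLift.fundamentalForm nabla phi eta xi p q)
          (fun z ↦ PSasakianLift.horLift nabla z (X z.1))
          (fun z ↦ PSasakianLift.vertLift z (X z.1))
          (fun z ↦ PSasakianLift.vertLift z (xi z.1)) u ≠ 0) := by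
  have hc := PSasakianLift.metallicMean_coeff_pos p hq
  -- Stated pointwise and with X nonzero rather than of unit length, so that it serves both the
  -- global field used against closedness and the local unit field.
  have hne : ∀ (X : ∀ x : M, TangentSpace 𝓘(ℝ, E) x) (u : TangentBundle 𝓘(ℝ, E) M),
      ContMDiffAt 𝓘(ℝ, E) (𝓘(ℝ, E).prod 𝓘(ℝ, E)) ∞
        (fun y ↦ (⟨y, X y⟩ : TangentBundle 𝓘(ℝ, E) M)) u.1 →
      (∀ᶠ x in nhds u.1, eta x (X x) = 0) → X u.1 ≠ 0 →
      PSasakianLift.coboundary (PSasakianLift.fundamentalForm nabla phi eta xi p q)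
        (fun z ↦ PSasakianLift.horLift nabla z (X z.1))
        (fun z ↦ PSasakianLift.vertLift z (X z.1))
        (fun z ↦ PSasakianLift.vertLift z (xi z.1)) u ≠ 0 := by
    intro X u hX heta hXu h0
    have h := hM.coboundary_horLift_vertLift_vertLift p q u hX heta
    rw [h0, mul_zero] at h
    exact mul_ne_zero (neg_ne_zero.2 hc.ne') (inner_self_ne_zero.2 hXu) h.symm
  refine ⟨fun hclosed ↦ ?_, fun U X hU hX hXU u hu ↦ ?_⟩
  · have hnabla := hM.leviCivita.smooth
    by_cases hdim : ∃ (x : M) (v : TangentSpace 𝓘(ℝ, E) x), eta x v = 0 ∧ v ≠ 0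
    · obtain ⟨x, v, hv, hv0⟩ := hdim
      obtain ⟨X, hX, hXeta, hXx⟩ := hM.exists_field_eta_eq_zero x hv
      -- Any point of the fibre over `x` would do: the value -c g(X, X) is constant along fibres.
      refine hne X ⟨x, 0⟩ (hX x) (Filter.Eventually.of_forall hXeta) (hXx.trans_ne hv0) ?_
      exact hclosed _ _ _ (hX.horLift nabla hnabla) hX.vertLift hM.smooth_xi.vertLift _
    -- In dimension one there is no field `X` as above. Since `Φ'` is symmetric, its coboundary is
    -- not tensorial, and the coefficient `η` of the first field contributes.
    · obtain ⟨x⟩ := (inferInstance : Nonempty M)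
      have h := hM.coboundary_smul_vertLift_vertLift_horLift p q ⟨x, 0⟩
      rw [hclosed _ _ _ (hM.contMDiff_eta.smul_section hM.smooth_xi.vertLift)
        hM.smooth_xi.vertLift (hM.smooth_xi.horLift nabla hnabla)] at h
      linarith
  · refine hne X u ((hX u.1 hu).contMDiffAt (hU.mem_nhds hu)) ?_ fun h0 ↦ ?_
    · filter_upwards [hU.mem_nhds hu] with x hx
      exact (hXU x hx).1
    · have h1 := (hXU u.1 hu).2
      rw [h0, inner_zero_left] at h1
      exact zero_ne_one h1
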